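/- Let $M$ be a matroid on a finite ground set $E$. A homogeneous polynomial $h \in \mathbb{R}[x_1,\dots,x_n]$ is \emph{hyperbolic} with respect to $e \in \mathbb{R}^n$ if $h(e) \neq 0$ and, for every $x \in \mathbb{R}^n$, the univariate polynomial $t \mapsto h(te - x)$ has only real zeros. These zeros, counted with multiplicity, are the \emph{eigenvalues} of $x$; the \emph{hyperbolicity cone} $\Lambda_+(h,e)$ is the set of all $x \in \mathbb{R}^n$ whose eigenvalues are all nonnegative, and the \emph{rank} $\mathrm{rk}(x)$ is the number of nonzero eigenvalues of $x$, counted with multiplicity. The matroid $M$ is \emph{hyperbolic} if there are $n \geq 0$, a polynomial $h \in \mathbb{R}[x_1,\dots,x_n]$ that is hyperbolic with respect to some $e \in \mathbb{R}^n$, and vectors $v_i \in \Lambda_+(h,e)$ $(i \in E)$ with $\mathrm{rk}(v_i) \leq 1$, such that the rank function $r_M$ of $M$ satisfies $$ r_M(S) = \mathrm{rk}\Big(\sum_{i \in S} v_i\Big) \qquad \text{for all } S \subseteq E. $$ A polynomial $P \in \mathbb{C}[x_i : i \in E]$ is \emph{stable} if $P(z) \neq 0$ whenever $\mathrm{Im}(z_i)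 > 0$ for all $i \in E$, and \emph{multiaffine} if each variable occurs in it at most to the first power. The matroid $M$ has the \emph{weak half-plane property} if there is a homogeneous, multiaffine and stable polynomial $P = \sum_{B \subseteq E} a(B) \prod_{i \in B} x_i \in \mathbb{C}[x_i : i \in E]$ such that the set of bases of $M$ is $\{B \subseteq E : a(B) \neq 0\}$. Then $M$ is hyperbolic if and only if $M$ has the weak half-plane property. -/

import Mathlib

noncomputable section

namespace HypMatroid

/-- The univariate real polynomial `t ↦ h(t e - x)`. -/
def charPoly {n : ℕ} (h : MvPolynomial (Fin n) ℝ) (e x : Fin n → ℝ) : Polynomial ℝ :=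
  MvPolynomial.aeval
    (fun i => Polynomial.C (e i) * Polynomial.X - Polynomial.C (x i)) h

/-- `h` is hyperbolic with respect to `e`: it is homogeneous, `h(e) ≠ 0`, and for every real
vector `x` all complex zeros of `t ↦ h(t e - x)` are real. -/
def IsHyperbolic {n : ℕ} (h : MvPolynomial (Fin n) ℝ) (e : Fin n → ℝ) : Prop :=
  (∃ d : ℕ, h.IsHomogeneous d) ∧ MvPolynomial.eval e h ≠ 0 ∧
    ∀ x : Fin n → ℝ, ∀ z : ℂ, Polynomial.aeval z (charPoly h e x) = 0 → z.im = 0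

/-- The eigenvalues of `x` with respect to `e`, i.e. the zeros of `t ↦ h(t e - x)`, counted with
multiplicity. -/
def eigenvalues {n : ℕ} (h : MvPolynomial (Fin n) ℝ) (e x : Fin n → ℝ) : Multiset ℝ :=
  (charPoly h e x).roots

/-- The hyperbolicity cone: the vectors all of whose eigenvalues are nonnegative. -/
def hyperbolicityCone {n : ℕ} (h : MvPolynomial (Fin n) ℝ) (e : Fin n → ℝ) :
    Set (Fin n → ℝ) :=
  {x | ∀ l ∈ eigenvalues h e x, 0 ≤ l}

open Classical in
/-- The hyperbolic rank of `x`: the number of nonzero eigenvalues, with multiplicity. -/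
def hypRank {n : ℕ} (h : MvPolynomial (Fin n) ℝ) (e x : Fin n → ℝ) : ℕ :=
  ((eigenvalues h e x).filter (fun l => l ≠ 0)).card

/-- The function `S ↦ rk (∑ i ∈ S, v i)` on the subsets of the index set of `v`. -/
def hypRankFn {E : Type*} {n : ℕ} (h : MvPolynomial (Fin n) ℝ) (e : Fin n → ℝ)
    (v : E → Fin n → ℝ) (S : Finset E) : ℕ :=
  hypRank h e (∑ i ∈ S, v i)

/-- A matroid whose ground set is the finite type `E` is hyperbolic if its rank function is that
of a tuple of vectors of rank at most one in a hyperbolicity cone. -/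
def IsHyperbolicMatroid {E : Type*} (M : Matroid E) : Prop :=
  ∃ (n : ℕ) (h : MvPolynomial (Fin n) ℝ) (e : Fin n → ℝ) (v : E → Fin n → ℝ),
    IsHyperbolic h e ∧
    (∀ i, v i ∈ hyperbolicityCone h e) ∧
    (∀ i, hypRank h e (v i) ≤ 1) ∧
    ∀ S : Finset E, M.eRk (S : Set E) = (hypRankFn h e v S : ℕ∞)

/-- A complex polynomial is stable if it does not vanish when all the variables are in the open
upper half-plane. -/
def IsStable {E : Type*} (P : MvPolynomial E ℂ) : Prop :=
  ∀ z : E → ℂ, (∀ i, 0 < (z i).im) → MvPolynomial.eval z P ≠ 0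

/-- Each variable occurs at most to the first power. -/
def IsMultiaffine {E : Type*} (P : MvPolynomial E ℂ) : Prop :=
  ∀ i, P.degreeOf i ≤ 1

/-- The coefficient of the squarefree monomial `∏ i ∈ B, x_i`. -/
def setCoeff {E : Type*} (P : MvPolynomial E ℂ) (B : Finset E) : ℂ :=
  P.coeff (∑ i ∈ B, Finsupp.single i 1)

/-- A matroid whose ground set is the finite type `E` has the weak half-plane property if its
bases are the support of a homogeneous, multiaffine, stable complex polynomial. -/
def HasWeakHalfPlaneProperty {E : Type*} (M : Matroid E) : Prop :=
  ∃ P : MvPolynomial E ℂ,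
    (∃ d : ℕ, P.IsHomogeneous d) ∧ IsMultiaffine P ∧ IsStable P ∧
    ∀ B : Finset E, M.IsBase (B : Set E) ↔ setCoeff P B ≠ 0

end HypMatroid

end

noncomputable section

namespace HypMatroid

/-! From hyperbolic to stable: write `d` for the degree of `h` and `r` for the rank of `∑ v i`. The
pencil `h (t e - ∑ x_i v_i)` is divisible by `t ^ (d - r)`, because ranks are monotone on the cone.
Its coefficient `P` of `t ^ (d - r)` is homogeneous of degree `r` in the `x_i`, and it is
multiaffine because `h` is affine along directions of rank at most one. For `|B| = r` the
coefficient of `x^B` is `P` at the indicator of `B`, and this is nonzero exactly when `∑ i ∈ B, v i`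
has rank `r`, that is, when `B` is a base. Stability follows from `|P (z)| ≥ |P (Im z)| ≥ |P (c,
..., c)| > 0`, a limit as `s → 0` of inequalities for `h` on the cone shifted by `s e`.

The analytic input is Gårding's theory: `h` has no zeros on the tube over the shifted cone. This is
a homotopy argument (`aeval_ne_zero_of_homotopy`). It gives convexity of the cone, monotonicity of
`|h|` (`abs_eval_le_abs_eval_add`) and the lower bound `abs_eval_le_norm_aeval`. Ranks are compared
as orders of vanishing at `0`, which size inequalities control (`X_pow_dvd_of_abs_eval_neg_le`).

From stable to hyperbolic: up to a scalar, the stable polynomial is a real `Q` with nonnegative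
coefficients. Take `h = Q`, `e` the all-ones vector and `v_i` the coordinate vectors. At the
indicator of `S` the characteristic polynomial is `∑_B Q_B (t - 1)^|B ∩ S| t^|B \ S|`. Its lowest
terms share a sign, so `0` has multiplicity `d - max |B ∩ S| = d - r_M(S)`. -/

open Polynomial in
/-- The restriction `t ↦ h (a + t b)` of a polynomial to a line. -/
def linePoly {σ R A : Type*} [CommRing R] [CommRing A] [Algebra R A]
    (h : MvPolynomial σ R) (a b : σ → A) : Polynomial A :=
  MvPolynomial.aeval (fun k => C (a k) + C (b k) * X) h

/-! ### Restrictions of polynomials to lines -/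

section LinePoly

variable {σ R A : Type*} [CommRing R] [CommRing A] [Algebra R A]

theorem eval_linePoly (h : MvPolynomial σ R) (a b : σ → A) (t : A) :
    (linePoly h a b).eval t = MvPolynomial.aeval (fun k => a k + t * b k) h := by
  unfold linePoly
  induction h using MvPolynomial.induction_on with
  | C r =>
    rw [MvPolynomial.aeval_C, MvPolynomial.aeval_C, Polynomial.algebraMap_apply, Polynomial.eval_C]
  | add p q hp hq => rw [map_add, map_add, Polynomial.eval_add, hp, hq]
  | mul_X p i hp =>
    rw [map_mul, map_mul, Polynomial.eval_mul, hp, MvPolynomial.aeval_X, MvPolynomial.aeval_X]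
    simp [mul_comm t]

theorem map_linePoly {B : Type*} [CommRing B] [Algebra R B] (f : A →ₐ[R] B)
    (h : MvPolynomial σ R) (a b : σ → A) :
    (linePoly h a b).map (f : A →+* B) = linePoly h (f ∘ a) (f ∘ b) := by
  unfold linePoly
  induction h using MvPolynomial.induction_on with
  | C r => simp [Polynomial.algebraMap_apply]
  | add p q hp hq => simp [hp, hq]
  | mul_X p i hp => simp [hp]

theorem aeval_mul_of_isHomogeneous {h : MvPolynomial σ R} {d : ℕ} (hh : h.IsHomogeneous d)
    (c : A) (z : σ → A) :
    MvPolynomial.aeval (fun k => c * z k) h = c ^ d * MvPolynomial.aeval z h := by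
  rw [MvPolynomial.aeval_def, MvPolynomial.aeval_def, MvPolynomial.eval₂_eq, MvPolynomial.eval₂_eq,
    Finset.mul_sum]
  refine Finset.sum_congr rfl fun m hm => ?_
  have hd : ∑ i ∈ m.support, m i = d := (hh.degree_eq_sum_deg_support hm).symm
  simp_rw [mul_pow]
  rw [Finset.prod_mul_distrib, Finset.prod_pow_eq_pow_sum, hd]
  ring

theorem natDegree_linePoly_le {h : MvPolynomial σ R} {d : ℕ} (hh : h.IsHomogeneous d)
    (a b : σ → A) : (linePoly h a b).natDegree ≤ d := by
  unfold linePoly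
  rw [MvPolynomial.aeval_def, MvPolynomial.eval₂_eq]
  refine Polynomial.natDegree_sum_le_of_forall_le _ _ fun m hm => ?_
  have hd : ∑ i ∈ m.support, m i = d := (hh.degree_eq_sum_deg_support hm).symm
  refine (Polynomial.natDegree_C_mul_le _ _).trans ?_
  refine (Polynomial.natDegree_prod_le _ _).trans ?_
  rw [← hd]
  refine Finset.sum_le_sum fun i _ => ?_
  refine Polynomial.natDegree_pow_le.trans ?_
  have : (Polynomial.C (a i) + Polynomial.C (b i) * Polynomial.X).natDegree ≤ 1 := by
    compute_degree
  nlinarith [Nat.zero_le (m i)]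

end LinePoly

section Field

variable {σ R A : Type*} [CommRing R] [Field A] [Infinite A] [Algebra R A]

/-- Homogeneity gives `h (b + t a) = t ^ d * h (a + t⁻¹ b)`, so exchanging base point and direction
reverses the coefficients. -/
theorem reflect_linePoly {h : MvPolynomial σ R} {d : ℕ} (hh : h.IsHomogeneous d)
    (a b : σ → A) : (linePoly h a b).reflect d = linePoly h b a := by
  refine Polynomial.eq_of_infinite_eval_eq _ _ ?_
  refine Set.Infinite.mono (s := {0}ᶜ) ?_ (Set.finite_singleton (0 : A)).infinite_compl
  intro t ht
  have ht0 : t ≠ 0 := ht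
  have ht1 : t⁻¹ ≠ 0 := inv_ne_zero ht0
  let _ : Invertible t⁻¹ := invertibleOfNonzero ht1
  have key := Polynomial.eval₂_reflect_mul_pow (RingHom.id A) t⁻¹ d (linePoly h a b)
    (natDegree_linePoly_le hh a b)
  rw [invOf_eq_inv, inv_inv] at key
  change Polynomial.eval t _ = Polynomial.eval t _
  change Polynomial.eval t _ * _ = Polynomial.eval _ _ at key
  rw [eval_linePoly] at key ⊢
  have h2 := aeval_mul_of_isHomogeneous hh t (fun k => a k + t⁻¹ * b k)
  rw [← key] at h2
  have h3 : (fun k => t * (a k + t⁻¹ * b k)) = fun k => b k + t * a k := by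
    funext k; field_simp; ring
  rw [h3] at h2
  rw [h2, mul_comm, mul_assoc, ← mul_pow, inv_mul_cancel₀ ht0]
  simp

theorem coeff_linePoly {h : MvPolynomial σ R} {d : ℕ} (hh : h.IsHomogeneous d)
    (a b : σ → A) {k : ℕ} (hk : k ≤ d) :
    (linePoly h a b).coeff k = (linePoly h b a).coeff (d - k) := by
  rw [← reflect_linePoly hh b a, Polynomial.coeff_reflect, Polynomial.revAt_le hk]

theorem coeff_linePoly_top {h : MvPolynomial σ R} {d : ℕ} (hh : h.IsHomogeneous d)
    (a b : σ → A) : (linePoly h a b).coeff d = MvPolynomial.aeval b h := by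
  rw [coeff_linePoly hh a b le_rfl, Nat.sub_self, Polynomial.coeff_zero_eq_eval_zero,
    eval_linePoly]
  simp

end Field

/-! ### Univariate estimates from the location of zeros -/

section Univariate

theorem norm_multiset_prod_sub_le {s : Multiset ℂ} {a b : ℂ}
    (h : ∀ ρ ∈ s, ‖a - ρ‖ ≤ ‖b - ρ‖) :
    ‖(s.map fun ρ => a - ρ).prod‖ ≤ ‖(s.map fun ρ => b - ρ).prod‖ := by
  induction s using Multiset.induction_on with
  | empty => simp
  | cons x s ih =>
    simp only [Multiset.map_cons, Multiset.prod_cons, norm_mul]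
    exact mul_le_mul (h x (by simp)) (ih fun ρ hρ => h ρ (by simp [hρ])) (norm_nonneg _)
      (norm_nonneg _)

theorem pow_card_le_norm_multiset_prod_sub {s : Multiset ℂ} {b : ℂ} {y : ℝ} (hy : 0 ≤ y)
    (h : ∀ ρ ∈ s, y ≤ ‖b - ρ‖) : y ^ s.card ≤ ‖(s.map fun ρ => b - ρ).prod‖ := by
  induction s using Multiset.induction_on with
  | empty => simp
  | cons x s ih =>
    simp only [Multiset.map_cons, Multiset.prod_cons, norm_mul, Multiset.card_cons, pow_succ']
    exact mul_le_mul (h x (by simp)) (ih fun ρ hρ => h ρ (by simp [hρ])) (pow_nonneg hy _)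
      (norm_nonneg _)

theorem norm_eval_le_of_roots {p : Polynomial ℂ} {a b : ℂ}
    (h : ∀ ρ, p.eval ρ = 0 → ‖a - ρ‖ ≤ ‖b - ρ‖) : ‖p.eval a‖ ≤ ‖p.eval b‖ := by
  have hs := IsAlgClosed.splits p
  rw [hs.eval_eq_prod_roots, hs.eval_eq_prod_roots, norm_mul, norm_mul]
  refine mul_le_mul_of_nonneg_left ?_ (norm_nonneg _)
  exact norm_multiset_prod_sub_le fun ρ hρ => h ρ (Polynomial.isRoot_of_mem_roots hρ)

/-- A polynomial without zeros in the open upper half-plane is bounded below there by its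
leading term. -/
theorem norm_coeff_mul_im_pow_le {p : Polynomial ℂ} {d : ℕ} (hd : p.natDegree ≤ d)
    (h : ∀ t : ℂ, 0 < t.im → p.eval t ≠ 0) {t : ℂ} (ht : 0 ≤ t.im) :
    ‖p.coeff d‖ * t.im ^ d ≤ ‖p.eval t‖ := by
  by_cases hc : p.coeff d = 0
  · simp [hc]
  have hd' : p.natDegree = d := le_antisymm hd (Polynomial.le_natDegree_of_ne_zero hc)
  have hs := IsAlgClosed.splits p
  rw [hs.eval_eq_prod_roots, norm_mul, Polynomial.leadingCoeff, hd']
  refine mul_le_mul_of_nonneg_left ?_ (norm_nonneg _)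
  rw [← hd', hs.natDegree_eq_card_roots]
  refine pow_card_le_norm_multiset_prod_sub ht fun ρ hρ => ?_
  have h1 : ρ.im ≤ 0 := not_lt.1 fun h2 => h ρ h2 (Polynomial.isRoot_of_mem_roots hρ)
  calc t.im ≤ (t - ρ).im := by simp [h1]
    _ ≤ |(t - ρ).im| := le_abs_self _
    _ ≤ _ := Complex.abs_im_le_norm _

/-- Every zero lies in the closed left half-plane, hence is at least as close to `0` as to `1`. -/
theorem norm_eval_zero_le_norm_eval_one {p : Polynomial ℂ}
    (h : ∀ t : ℂ, 0 < t.re → p.eval t ≠ 0) : ‖p.eval 0‖ ≤ ‖p.eval 1‖ := by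
  refine norm_eval_le_of_roots fun ρ hρ => ?_
  have h1 : ρ.re ≤ 0 := not_lt.1 fun h2 => h ρ h2 hρ
  rw [← sq_le_sq₀ (norm_nonneg _) (norm_nonneg _), ← Complex.normSq_eq_norm_sq,
    ← Complex.normSq_eq_norm_sq, Complex.normSq_apply, Complex.normSq_apply]
  simp
  nlinarith

/-- If the zeros of a polynomial are real and nonpositive, its constant term is a nonnegative
multiple of its leading coefficient. -/
theorem exists_eval_zero_eq_leadingCoeff_mul {p : Polynomial ℂ}
    (h : ∀ t : ℂ, p.eval t = 0 → t.im = 0 ∧ t.re ≤ 0) :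
    ∃ r : ℝ, 0 ≤ r ∧ p.eval 0 = p.leadingCoeff * r := by
  rw [(IsAlgClosed.splits p).eval_eq_prod_roots]
  suffices H : ∀ s : Multiset ℂ, (∀ ρ ∈ s, ρ.im = 0 ∧ ρ.re ≤ 0) →
      ∃ r : ℝ, 0 ≤ r ∧ (s.map fun ρ => 0 - ρ).prod = (r : ℂ) by
    obtain ⟨r, hr, h1⟩ := H p.roots fun ρ hρ => h ρ (Polynomial.isRoot_of_mem_roots hρ)
    exact ⟨r, hr, by rw [h1]⟩
  intro s hs
  induction s using Multiset.induction_on with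
  | empty => exact ⟨1, by simp⟩
  | cons x s ih =>
    obtain ⟨r, hr, h1⟩ := ih fun ρ hρ => hs ρ (by simp [hρ])
    obtain ⟨h2, h3⟩ := hs x (by simp)
    refine ⟨-x.re * r, mul_nonneg (by linarith) hr, ?_⟩
    have : x = (x.re : ℂ) := Complex.ext (by simp) (by simp [h2])
    simp only [Multiset.map_cons, Multiset.prod_cons]
    rw [h1, this]
    simp

-- A limit gives `p (0) = 0`, and a factor `X` cancels on both sides. Negative arguments are used
-- because `t = -s` in `h (t e - x)` is, up to sign, the point `x + s e`.
open Polynomial Filter Topology in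
theorem X_pow_dvd_of_abs_eval_neg_le {p q : Polynomial ℝ} {m : ℕ}
    (h : ∀ s : ℝ, 0 < s → |p.eval (-s)| ≤ |q.eval (-s)|) (hq : X ^ m ∣ q) : X ^ m ∣ p := by
  induction m generalizing p q with
  | zero => simp
  | succ m ih =>
    obtain ⟨q', rfl⟩ := hq
    have hp0 : p.eval 0 = 0 := by
      have h1 : Tendsto (fun s : ℝ => |p.eval (-s)|) (𝓝[>] 0) (𝓝 |p.eval (-0)|) :=
        (Continuous.tendsto (by fun_prop) (0 : ℝ)).mono_left nhdsWithin_le_nhds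
      have h2 : Tendsto (fun s : ℝ => |(X ^ (m + 1) * q').eval (-s)|) (𝓝[>] 0)
          (𝓝 |(X ^ (m + 1) * q').eval (-0)|) :=
        (Continuous.tendsto (by fun_prop) (0 : ℝ)).mono_left nhdsWithin_le_nhds
      have := le_of_tendsto_of_tendsto h1 h2
        (by filter_upwards [self_mem_nhdsWithin] with s hs using h s hs)
      simpa using this
    obtain ⟨p', rfl⟩ : X ∣ p := X_dvd_iff.2 (by rwa [coeff_zero_eq_eval_zero])
    rw [pow_succ', mul_comm X p', mul_comm X]
    refine mul_dvd_mul_right (ih (q := X ^ m * q') (fun s hs => ?_) (dvd_mul_right _ _)) X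
    have := h s hs
    simp only [eval_mul, eval_X, eval_pow, abs_mul, pow_succ', abs_neg] at this ⊢
    have hs' : 0 < |s| := by positivity
    rw [mul_assoc] at this
    simpa using le_of_mul_le_mul_left this hs'

end Univariate

/-! ### Zero-free tubes and convexity of the hyperbolicity cone -/

section Complexification

theorem continuous_aeval {σ : Type*} (h : MvPolynomial σ ℝ) :
    Continuous fun z : σ → ℂ => MvPolynomial.aeval z h := by
  simp_rw [MvPolynomial.aeval_def, MvPolynomial.eval₂_eq_eval_map]
  exact MvPolynomial.continuous_eval _

theorem aeval_ofReal {σ : Type*} (h : MvPolynomial σ ℝ) (x : σ → ℝ) :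
    MvPolynomial.aeval (fun k => ((x k : ℝ) : ℂ)) h = ((MvPolynomial.eval x h : ℝ) : ℂ) := by
  exact MvPolynomial.aeval_algebraMap_apply ℂ x h

theorem aeval_self_eq_eval {σ R : Type*} [CommSemiring R] (h : MvPolynomial σ R) (x : σ → R) :
    MvPolynomial.aeval x h = MvPolynomial.eval x h := by
  rw [← MvPolynomial.coe_aeval_eq_eval]
  rfl

variable {n : ℕ} {h : MvPolynomial (Fin n) ℝ} {e : Fin n → ℝ}

theorem charPoly_eq_linePoly (h : MvPolynomial (Fin n) ℝ) (e x : Fin n → ℝ) :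
    charPoly h e x = linePoly h (fun k => -x k) e := by
  unfold charPoly linePoly
  congr 2
  funext k
  simp [sub_eq_neg_add]

theorem map_ofReal_linePoly (h : MvPolynomial (Fin n) ℝ) (a b : Fin n → ℝ) :
    (linePoly h a b).map (algebraMap ℝ ℂ)
      = linePoly h (fun k => (a k : ℂ)) (fun k => (b k : ℂ)) :=
  map_linePoly (Algebra.ofId ℝ ℂ) h a b

theorem aeval_charPoly (h : MvPolynomial (Fin n) ℝ) (e x : Fin n → ℝ) (z : ℂ) :
    Polynomial.aeval z (charPoly h e x)
      = MvPolynomial.aeval (fun k => -(x k : ℂ) + z * (e k : ℂ)) h := by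
  rw [charPoly_eq_linePoly, Polynomial.aeval_def, Polynomial.eval₂_eq_eval_map,
    map_ofReal_linePoly, eval_linePoly]
  simp

theorem eval_charPoly (h : MvPolynomial (Fin n) ℝ) (e x : Fin n → ℝ) (s : ℝ) :
    (charPoly h e x).eval s = MvPolynomial.eval (fun k => -x k + s * e k) h := by
  rw [charPoly_eq_linePoly, eval_linePoly, aeval_self_eq_eval]

theorem IsHyperbolic.im_eq_zero (H : IsHyperbolic h e) (u : Fin n → ℝ) {z : ℂ}
    (hz : MvPolynomial.aeval (fun k => (u k : ℂ) + z * (e k : ℂ)) h = 0) : z.im = 0 := by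
  refine H.2.2 (fun k => -u k) z ?_
  rw [aeval_charPoly]
  simpa using hz

theorem charPoly_coeff_top {d : ℕ} (hh : h.IsHomogeneous d) (x : Fin n → ℝ) :
    (charPoly h e x).coeff d = MvPolynomial.eval e h := by
  rw [charPoly_eq_linePoly, coeff_linePoly_top hh, aeval_self_eq_eval]

theorem IsHyperbolic.charPoly_ne_zero (H : IsHyperbolic h e) (x : Fin n → ℝ) :
    charPoly h e x ≠ 0 := by
  obtain ⟨⟨d, hh⟩, he, -⟩ := H
  intro h0
  exact he (by rw [← charPoly_coeff_top hh x, h0, Polynomial.coeff_zero])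

theorem eval_neg_of_isHomogeneous {d : ℕ} (hh : h.IsHomogeneous d) (z : Fin n → ℂ) :
    MvPolynomial.aeval (fun k => -z k) h = (-1) ^ d * MvPolynomial.aeval z h := by
  rw [← aeval_mul_of_isHomogeneous hh]
  simp

theorem IsHyperbolic.zero_of_mem_cone (H : IsHyperbolic h e) {v : Fin n → ℝ}
    (hv : v ∈ hyperbolicityCone h e) {z : ℂ}
    (hz : MvPolynomial.aeval (fun k => (v k : ℂ) + z * (e k : ℂ)) h = 0) :
    z.im = 0 ∧ z.re ≤ 0 := by
  obtain ⟨d, hh⟩ := H.1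
  have him := H.im_eq_zero v hz
  refine ⟨him, ?_⟩
  have hzre : z = (z.re : ℂ) := Complex.ext (by simp) (by simp [him])
  have hroot : (charPoly h e v).eval (-z.re) = 0 := by
    rw [eval_charPoly, ← Complex.ofReal_eq_zero, ← aeval_ofReal]
    have h1 : (fun k => (((-v k + -z.re * e k : ℝ)) : ℂ))
        = fun k => -((v k : ℂ) + z * (e k : ℂ)) := by
      funext k; rw [hzre]; push_cast; simp; ring
    rw [h1, eval_neg_of_isHomogeneous hh, hz, mul_zero]
  have := hv (-z.re) ((Polynomial.mem_roots (H.charPoly_ne_zero v)).2 hroot)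
  linarith

theorem mem_hyperbolicityCone_of_forall_pos (hh : ∃ d, h.IsHomogeneous d) {v : Fin n → ℝ}
    (hv : ∀ s : ℝ, 0 < s → MvPolynomial.eval (fun k => v k + s * e k) h ≠ 0) :
    v ∈ hyperbolicityCone h e := by
  obtain ⟨d, hh⟩ := hh
  intro l hl
  have h1 : (charPoly h e v).eval l = 0 := Polynomial.isRoot_of_mem_roots hl
  by_contra hneg
  refine hv (-l) (by linarith) ?_
  rw [eval_charPoly] at h1
  have h2 := aeval_mul_of_isHomogeneous hh (-1 : ℝ) (fun k => -v k + l * e k)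
  simp only [aeval_self_eq_eval] at h2
  rw [h1, mul_zero] at h2
  rw [← h2]
  congr 2
  funext k; ring

theorem IsHyperbolic.eval_ne_zero_of_mem_cone (H : IsHyperbolic h e) {v : Fin n → ℝ}
    (hv : v ∈ hyperbolicityCone h e) {s : ℝ} (hs : 0 < s) :
    MvPolynomial.eval (fun k => v k + s * e k) h ≠ 0 := by
  intro h0
  have := (H.zero_of_mem_cone hv (z := s) (by
    have := aeval_ofReal h fun k => v k + s * e k
    rw [h0] at this
    simpa using this)).2
  simp at this
  linarith

theorem IsHyperbolic.smul_mem_cone (H : IsHyperbolic h e) {v : Fin n → ℝ}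
    (hv : v ∈ hyperbolicityCone h e) {a : ℝ} (ha : 0 < a) :
    (fun k => a * v k) ∈ hyperbolicityCone h e := by
  refine mem_hyperbolicityCone_of_forall_pos H.1 fun s hs => ?_
  obtain ⟨d, hh⟩ := H.1
  have h2 := aeval_mul_of_isHomogeneous hh a (fun k => v k + s / a * e k)
  simp only [aeval_self_eq_eval] at h2
  have h3 : (fun k => a * v k + s * e k) = fun k => a * (v k + s / a * e k) := by
    funext k; field_simp
  rw [h3, h2]
  exact mul_ne_zero (pow_ne_zero _ ha.ne') (H.eval_ne_zero_of_mem_cone hv (by positivity))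

open Filter Topology Set in
/-- Zeros of `t ↦ h (θ z + c + t w)` that never meet the real line while `θ` runs through `[0, 1]`
stay in the lower half-plane. -/
theorem aeval_ne_zero_of_homotopy {d : ℕ} (hh : h.IsHomogeneous d) {z w c : Fin n → ℂ}
    (hw : MvPolynomial.aeval w h ≠ 0)
    (h0 : ∀ t : ℂ, 0 ≤ t.im → MvPolynomial.aeval (fun k => c k + t * w k) h ≠ 0)
    (hr : ∀ θ ∈ Icc (0 : ℝ) 1, ∀ t : ℝ,
      MvPolynomial.aeval (fun k => θ * z k + c k + t * w k) h ≠ 0) {t : ℂ} (ht : 0 ≤ t.im) :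
    MvPolynomial.aeval (fun k => z k + c k + t * w k) h ≠ 0 := by
  set F : ℝ → ℂ → ℂ := fun θ t => MvPolynomial.aeval (fun k => θ * z k + c k + t * w k) h with hF
  have hcont : Continuous fun p : ℝ × ℂ => F p.1 p.2 := by
    refine (continuous_aeval h).comp ?_
    fun_prop
  set G : Set ℝ := {θ | ∀ t : ℂ, 0 ≤ t.im → F θ t ≠ 0} with hG
  have hline : ∀ θ t, F θ t = (linePoly h (fun k => θ * z k + c k) w).eval t := fun θ t => by
    rw [eval_linePoly]
  -- Real zeros are excluded by `hr`, so membership in `G` amounts to the lower bound by the leading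
  -- term, a closed condition on `θ`.
  have hclosed : IsClosed (G ∩ Icc 0 1) := by
    have : G ∩ Icc 0 1 = {θ | ∀ t : ℂ, 0 < t.im →
        ‖MvPolynomial.aeval w h‖ * t.im ^ d ≤ ‖F θ t‖} ∩ Icc 0 1 := by
      ext θ
      refine and_congr_left fun hθ => ⟨fun hg t ht => ?_, fun hg t ht => ?_⟩
      · rw [hline, ← coeff_linePoly_top hh (fun k => θ * z k + c k) w]
        exact norm_coeff_mul_im_pow_le (natDegree_linePoly_le hh _ _)
          (fun t ht => by rw [← hline]; exact hg t ht.le) ht.le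
      · rcases ht.eq_or_lt with h1 | h1
        · have h2 : t = (t.re : ℂ) := Complex.ext (by simp) (by simp [← h1])
          rw [h2]
          exact hr θ hθ t.re
        · intro h2
          have := hg t h1
          rw [h2, norm_zero] at this
          have h3 : 0 < ‖MvPolynomial.aeval w h‖ * t.im ^ d := by positivity
          linarith
    rw [this]
    refine IsClosed.inter ?_ isClosed_Icc
    simp only [ofPred_forall]
    refine isClosed_iInter fun t => isClosed_iInter fun _ => isClosed_le continuous_const ?_
    exact (hcont.comp (by fun_prop : Continuous fun θ : ℝ => (θ, t))).norm
  -- No zeros come in from infinity: for large `t` the point divided by `t` is close to `w`, where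
  -- `h` does not vanish.
  obtain ⟨R, hR⟩ : ∃ R : ℝ, ∀ θ ∈ Icc (0 : ℝ) 1, ∀ t : ℂ, F θ t = 0 → ‖t‖ ≤ R := by
    have hev : ∀ᶠ y in 𝓝 w, MvPolynomial.aeval y h ≠ 0 :=
      (continuous_aeval h).continuousAt.eventually_ne hw
    obtain ⟨δ, hδ, hball⟩ := Metric.eventually_nhds_iff.1 hev
    refine ⟨(‖z‖ + ‖c‖) / δ + 1, fun θ hθ t hFt => ?_⟩
    by_contra! hlt
    have hpos : 0 ≤ (‖z‖ + ‖c‖) / δ := by positivity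
    have ht0 : 0 < ‖t‖ := by linarith
    have htne : t ≠ 0 := norm_pos_iff.1 ht0
    refine hball (y := fun k => w k + t⁻¹ * (θ * z k + c k)) ?_ ?_
    · rw [dist_eq_norm]
      have h1 : (fun k => w k + t⁻¹ * (θ * z k + c k)) - w = t⁻¹ • ((θ : ℂ) • z + c) := by
        funext k; simp
      rw [h1, norm_smul, norm_inv, inv_mul_lt_iff₀ ht0]
      have h2 : ‖(θ : ℂ) • z + c‖ ≤ ‖z‖ + ‖c‖ := by
        refine (norm_add_le _ _).trans (add_le_add_left ?_ _)
        rw [norm_smul]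
        have : ‖(θ : ℂ)‖ ≤ 1 := by
          rw [Complex.norm_real, Real.norm_eq_abs, abs_of_nonneg hθ.1]; exact hθ.2
        exact mul_le_of_le_one_left (norm_nonneg _) this
      have h3 : ‖z‖ + ‖c‖ < ‖t‖ * δ := by
        rw [← div_lt_iff₀ hδ]; linarith
      linarith
    · have h1 := aeval_mul_of_isHomogeneous hh t⁻¹ (fun k => θ * z k + c k + t * w k)
      change _ = t⁻¹ ^ d * F θ t at h1
      rw [hFt, mul_zero] at h1
      rw [← h1]
      congr 2
      funext k
      field_simp
      ring
  have hsub : Icc (0 : ℝ) 1 ⊆ G := by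
    refine hclosed.Icc_subset_of_forall_mem_nhdsWithin ?_ ?_
    · intro t ht
      simpa [hF] using h0 t ht
    · rintro θ ⟨hθG, hθ⟩
      -- The set of bad pairs is compact, so the bad parameters form a closed set, and it misses
      -- `θ`.
      set K : Set (ℝ × ℂ) := (Icc (0 : ℝ) 1 ×ˢ Metric.closedBall (0 : ℂ) R) ∩
        {p | 0 ≤ p.2.im ∧ F p.1 p.2 = 0} with hK
      have hKc : IsCompact K := by
        refine (isCompact_Icc.prod (isCompact_closedBall _ _)).inter_right ?_
        exact (isClosed_le continuous_const
          (Complex.continuous_im.comp continuous_snd)).inter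
          (isClosed_eq hcont continuous_const)
      have hKi : IsClosed (Prod.fst '' K) := (hKc.image continuous_fst).isClosed
      have hmem : (Prod.fst '' K)ᶜ ∈ 𝓝 θ := by
        refine hKi.isOpen_compl.mem_nhds ?_
        rintro ⟨⟨θ', t⟩, ⟨-, h1, h2⟩, rfl⟩
        exact hθG t h1 h2
      filter_upwards [mem_nhdsWithin_of_mem_nhds hmem, Ioo_mem_nhdsGT hθ.2] with θ' h1 h2 t ht hFt
      have hI : θ' ∈ Icc (0 : ℝ) 1 := ⟨hθ.1.trans h2.1.le, h2.2.le⟩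
      exact h1 ⟨(θ', t), ⟨⟨hI, by simpa using hR θ' hI t hFt⟩, ht, hFt⟩, rfl⟩
  have := hsub (right_mem_Icc.2 zero_le_one) t ht
  simpa [hF] using this

/-- The start of the homotopy. After division by `t`, a zero makes `t⁻¹ I + ε` a zero of `s ↦ h (v +
s e)`, but its real part is `ε + Im t / |t|² > 0`. -/
theorem IsHyperbolic.aeval_I_add_ne_zero (H : IsHyperbolic h e) {v : Fin n → ℝ}
    (hv : v ∈ hyperbolicityCone h e) {ε : ℝ} (hε : 0 < ε) {t : ℂ} (ht : 0 ≤ t.im) :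
    MvPolynomial.aeval
      (fun k => Complex.I * (e k : ℂ) + t * ((v k : ℂ) + (ε : ℂ) * (e k : ℂ))) h ≠ 0 := by
  obtain ⟨d, hh⟩ := H.1
  intro h0
  by_cases ht0 : t = 0
  · subst ht0
    simp only [zero_mul, add_zero] at h0
    rw [aeval_mul_of_isHomogeneous hh, aeval_ofReal] at h0
    exact mul_ne_zero (pow_ne_zero _ Complex.I_ne_zero) (Complex.ofReal_ne_zero.2 H.2.1) h0
  · have h1 := aeval_mul_of_isHomogeneous hh t⁻¹
      (fun k => Complex.I * (e k : ℂ) + t * ((v k : ℂ) + (ε : ℂ) * (e k : ℂ)))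
    rw [h0, mul_zero] at h1
    have h2 := H.zero_of_mem_cone hv (z := t⁻¹ * Complex.I + ε) (by
      rw [← h1]; congr 2; funext k; field_simp; ring)
    obtain ⟨h3, h4⟩ := h2
    simp [Complex.inv_im, Complex.inv_re] at h3 h4
    rw [neg_div] at h4
    have h5 : 0 ≤ t.im / Complex.normSq t := div_nonneg ht (Complex.normSq_nonneg _)
    linarith

theorem IsHyperbolic.aeval_add_ne_zero (H : IsHyperbolic h e) {v : Fin n → ℝ}
    (hv : v ∈ hyperbolicityCone h e) {ε : ℝ} (hε : 0 < ε) {z : Fin n → ℂ}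
    (hr : ∀ θ ∈ Set.Icc (0 : ℝ) 1, ∀ t : ℝ, MvPolynomial.aeval (fun k => θ * z k +
      Complex.I * (e k : ℂ) + t * ((v k : ℂ) + (ε : ℂ) * (e k : ℂ))) h ≠ 0)
    {t : ℂ} (ht : 0 ≤ t.im) :
    MvPolynomial.aeval (fun k => z k + Complex.I * (e k : ℂ) +
      t * ((v k : ℂ) + (ε : ℂ) * (e k : ℂ))) h ≠ 0 := by
  obtain ⟨d, hh⟩ := H.1
  refine aeval_ne_zero_of_homotopy hh (w := fun k => (v k : ℂ) + (ε : ℂ) * (e k : ℂ)) ?_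
    (fun t ht => H.aeval_I_add_ne_zero hv hε ht) hr ht
  have := aeval_ofReal h fun k => v k + ε * e k
  push_cast at this
  rw [this]
  exact Complex.ofReal_ne_zero.2 (H.eval_ne_zero_of_mem_cone hv hε)

theorem IsHyperbolic.aeval_tube_one (H : IsHyperbolic h e) {v : Fin n → ℝ}
    (hv : v ∈ hyperbolicityCone h e) {ε : ℝ} (hε : 0 < ε) (u : Fin n → ℝ)
    {t : ℂ} (ht : 0 ≤ t.im) :
    MvPolynomial.aeval (fun k => (u k : ℂ) + Complex.I * (e k : ℂ) +
      t * ((v k : ℂ) + (ε : ℂ) * (e k : ℂ))) h ≠ 0 := by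
  refine H.aeval_add_ne_zero hv hε (z := fun k => (u k : ℂ)) (fun θ _ t h0 => ?_) ht
  have := H.im_eq_zero (fun k => θ * u k + t * (v k + ε * e k)) (z := Complex.I) (by
    rw [← h0]; congr 2; funext k; push_cast; ring)
  simp at this

/-- A second homotopy: for real `t` the `w`-term joins the real part `u`, and `aeval_tube_one`
applies with `θ s` in place of `s`. -/
theorem IsHyperbolic.aeval_tube_two (H : IsHyperbolic h e) {v w : Fin n → ℝ}
    (hv : v ∈ hyperbolicityCone h e) (hw : w ∈ hyperbolicityCone h e) {ε : ℝ} (hε : 0 < ε)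
    (u : Fin n → ℝ) {s t : ℂ} (hs : 0 ≤ s.im) (ht : 0 ≤ t.im) :
    MvPolynomial.aeval (fun k => (u k : ℂ) + s * ((v k : ℂ) + (ε : ℂ) * (e k : ℂ)) +
      Complex.I * (e k : ℂ) + t * ((w k : ℂ) + (ε : ℂ) * (e k : ℂ))) h ≠ 0 := by
  refine H.aeval_add_ne_zero hw hε
    (z := fun k => (u k : ℂ) + s * ((v k : ℂ) + (ε : ℂ) * (e k : ℂ))) (fun θ hθ t h0 => ?_) ht
  refine H.aeval_tube_one hv hε (fun k => θ * u k + t * (w k + ε * e k)) (t := θ * s) ?_ ?_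
  · simpa using mul_nonneg hθ.1 hs
  · rw [← h0]; congr 2; funext k; push_cast; ring

/-- The hyperbolicity cone is closed under addition. -/
theorem IsHyperbolic.add_mem_cone (H : IsHyperbolic h e) {v w : Fin n → ℝ}
    (hv : v ∈ hyperbolicityCone h e) (hw : w ∈ hyperbolicityCone h e) :
    (fun k => v k + w k) ∈ hyperbolicityCone h e := by
  refine mem_hyperbolicityCone_of_forall_pos H.1 fun s hs h0 => ?_
  obtain ⟨d, hh⟩ := H.1
  -- With both parameters equal to `2 I / s`, the two shifts by `s / 4` and the summand `I e` add up
  -- to `(2 I / s) (v + w + s e)`.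
  have hε : 0 < s / 4 := by positivity
  have hI : (0 : ℝ) ≤ (Complex.I * ((2 / s : ℝ) : ℂ)).im := by simp; positivity
  refine H.aeval_tube_two hv hw hε 0 hI hI ?_
  have h1 := aeval_mul_of_isHomogeneous hh (Complex.I * ((2 / s : ℝ) : ℂ))
    (fun k => ((v k + w k + s * e k : ℝ) : ℂ))
  rw [aeval_ofReal, h0, Complex.ofReal_zero, mul_zero] at h1
  rw [← h1]
  congr 2
  funext k
  have : (s : ℂ) ≠ 0 := Complex.ofReal_ne_zero.2 hs.ne'
  push_cast
  simp
  field_simp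
  ring

theorem IsHyperbolic.aeval_tube (H : IsHyperbolic h e) {v : Fin n → ℝ}
    (hv : v ∈ hyperbolicityCone h e) {s : ℝ} (hs : 0 < s) (u : Fin n → ℝ) :
    MvPolynomial.aeval (fun k => (u k : ℂ) + Complex.I * ((v k : ℂ) + (s : ℂ) * (e k : ℂ))) h
      ≠ 0 := by
  obtain ⟨d, hh⟩ := H.1
  intro h0
  have hI : (0 : ℝ) ≤ (Complex.I * ((2 / s : ℝ) : ℂ)).im := by simp; positivity
  refine H.aeval_tube_one hv (half_pos hs) (fun k => 2 / s * u k) hI ?_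
  have h1 := aeval_mul_of_isHomogeneous hh ((2 / s : ℝ) : ℂ)
    (fun k => (u k : ℂ) + Complex.I * ((v k : ℂ) + (s : ℂ) * (e k : ℂ)))
  rw [h0, mul_zero] at h1
  rw [← h1]
  congr 2
  funext k
  have : (s : ℂ) ≠ 0 := Complex.ofReal_ne_zero.2 hs.ne'
  push_cast
  field_simp
  ring

/-- The polynomial `t ↦ h (u + t (v + s e))` has no zeros in the upper half-plane, so at `t = I` it
is bounded below by its coefficient of degree `d`. Unlike mere nonvanishing, this bound survives `s
→ 0`. -/
theorem IsHyperbolic.abs_eval_le_norm_aeval (H : IsHyperbolic h e) {v : Fin n → ℝ}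
    (hv : v ∈ hyperbolicityCone h e) {s : ℝ} (hs : 0 < s) (u : Fin n → ℝ) :
    |MvPolynomial.eval (fun k => v k + s * e k) h| ≤
      ‖MvPolynomial.aeval
        (fun k => (u k : ℂ) + Complex.I * ((v k : ℂ) + (s : ℂ) * (e k : ℂ))) h‖ := by
  obtain ⟨d, hh⟩ := H.1
  have key := norm_coeff_mul_im_pow_le
    (natDegree_linePoly_le hh (fun k => (u k : ℂ)) (fun k => (v k : ℂ) + (s : ℂ) * (e k : ℂ)))
    (fun t ht h0 => ?_) (t := Complex.I) (by simp)
  · rw [coeff_linePoly_top hh, eval_linePoly] at key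
    have h1 := aeval_ofReal h fun k => v k + s * e k
    push_cast at h1
    rw [h1, Complex.norm_real] at key
    simpa using key
  · rw [eval_linePoly] at h0
    refine H.aeval_tube (H.smul_mem_cone hv ht) (mul_pos ht hs)
      (fun k => u k + t.re * (v k + s * e k)) ?_
    rw [← h0]
    congr 2
    funext k
    conv_rhs => rw [← Complex.re_add_im t]
    push_cast
    ring

/-- A hyperbolic polynomial is monotone in absolute value on its hyperbolicity cone. -/
theorem IsHyperbolic.abs_eval_le_abs_eval_add (H : IsHyperbolic h e) {v w : Fin n → ℝ}
    (hv : v ∈ hyperbolicityCone h e) (hw : w ∈ hyperbolicityCone h e) {s : ℝ} (hs : 0 < s) :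
    |MvPolynomial.eval (fun k => v k + s * e k) h| ≤
      |MvPolynomial.eval (fun k => v k + s * e k + w k) h| := by
  obtain ⟨d, hh⟩ := H.1
  have key := norm_eval_zero_le_norm_eval_one
    (p := linePoly h (fun k => ((v k + s * e k : ℝ) : ℂ)) (fun k => (w k : ℂ)))
    (fun t ht h0 => ?_)
  · rw [eval_linePoly, eval_linePoly] at key
    simp only [zero_mul, add_zero, one_mul, ← Complex.ofReal_add] at key
    rw [aeval_ofReal, aeval_ofReal, Complex.norm_real, Complex.norm_real] at key
    exact key
  · rw [eval_linePoly] at h0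
    -- Multiplication by `I` turns `v + s e + t w` with `Re t > 0` into a point of the tube, with
    -- imaginary part `v + Re t • w + s e`.
    have h1 := aeval_mul_of_isHomogeneous hh Complex.I
      (fun k => ((v k + s * e k : ℝ) : ℂ) + t * (w k : ℂ))
    rw [h0, mul_zero] at h1
    refine H.aeval_tube (H.add_mem_cone hv (H.smul_mem_cone hw ht)) hs
      (fun k => -t.im * w k) ?_
    rw [← h1]
    congr 2
    funext k
    conv_rhs => rw [← Complex.re_add_im t]
    push_cast
    linear_combination (-t.im * w k : ℂ) * Complex.I_mul_I

end Complexification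

/-! ### Rank as order of vanishing -/

section Rank

open Polynomial

variable {n : ℕ} {h : MvPolynomial (Fin n) ℝ} {e : Fin n → ℝ}

theorem IsHyperbolic.splits_charPoly (H : IsHyperbolic h e) (x : Fin n → ℝ) :
    (charPoly h e x).Splits := by
  refine Splits.of_splits_map (algebraMap ℝ ℂ) (IsAlgClosed.splits _) fun z hz => ?_
  have h1 : aeval z (charPoly h e x) = 0 := by
    rw [aeval_def, eval₂_eq_eval_map]
    exact isRoot_of_mem_roots hz
  have h2 := H.2.2 x z h1
  exact ⟨z.re, Complex.ext (by simp) (by simp [h2])⟩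

theorem IsHyperbolic.natDegree_charPoly (H : IsHyperbolic h e) {d : ℕ} (hh : h.IsHomogeneous d)
    (x : Fin n → ℝ) : (charPoly h e x).natDegree = d := by
  refine le_antisymm ?_ (le_natDegree_of_ne_zero ?_)
  · rw [charPoly_eq_linePoly]
    exact natDegree_linePoly_le hh _ _
  · rw [charPoly_coeff_top hh]
    exact H.2.1

/-- All `d` zeros of the characteristic polynomial are real, so the rank counts those that are not
`0`. Rank bounds thereby become divisibility by powers of `X`. -/
theorem IsHyperbolic.hypRank_add_rootMultiplicity (H : IsHyperbolic h e) {d : ℕ}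
    (hh : h.IsHomogeneous d) (x : Fin n → ℝ) :
    hypRank h e x + (charPoly h e x).rootMultiplicity 0 = d := by
  classical
  rw [← H.natDegree_charPoly hh x, (H.splits_charPoly x).natDegree_eq_card_roots,
    ← count_roots, Multiset.count_eq_card_filter_eq]
  unfold hypRank eigenvalues
  rw [← Multiset.card_add]
  have h1 : Multiset.filter (fun l => ¬ l ≠ 0) (charPoly h e x).roots
      = Multiset.filter (fun l => 0 = l) (charPoly h e x).roots :=
    Multiset.filter_congr fun a _ => by simp [eq_comm]
  conv_rhs => rw [← Multiset.filter_add_not (fun l : ℝ => l ≠ 0) (charPoly h e x).roots, h1]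

theorem IsHyperbolic.X_pow_dvd_charPoly_iff (H : IsHyperbolic h e) {d : ℕ}
    (hh : h.IsHomogeneous d) (x : Fin n → ℝ) {m : ℕ} :
    X ^ m ∣ charPoly h e x ↔ hypRank h e x + m ≤ d := by
  have h1 := le_rootMultiplicity_iff (H.charPoly_ne_zero x) (a := 0) (n := m)
  rw [map_zero, sub_zero] at h1
  rw [← h1]
  have := H.hypRank_add_rootMultiplicity hh x
  omega

theorem IsHyperbolic.hypRank_le (H : IsHyperbolic h e) {d : ℕ}
    (hh : h.IsHomogeneous d) (x : Fin n → ℝ) : hypRank h e x ≤ d := by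
  have := H.hypRank_add_rootMultiplicity hh x
  omega

/-- For a vector of rank at most `r`, the coefficient of `t ^ (d - r)` in `h (t e - x)` detects
whether the rank is `r`. -/
theorem IsHyperbolic.coeff_charPoly_ne_zero_iff (H : IsHyperbolic h e) {d r : ℕ}
    (hh : h.IsHomogeneous d) {x : Fin n → ℝ} (hx : hypRank h e x ≤ r) (hr : r ≤ d) :
    (charPoly h e x).coeff (d - r) ≠ 0 ↔ hypRank h e x = r := by
  have h1 : X ^ (d - r) ∣ charPoly h e x := (H.X_pow_dvd_charPoly_iff hh x).2 (by omega)
  have h2 := H.X_pow_dvd_charPoly_iff hh x (m := d - r + 1)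
  rw [X_pow_dvd_iff] at h1 h2
  constructor
  · intro hne
    by_contra hlt
    exact hne (h2.2 (by omega) _ (Nat.lt_succ_self _))
  · intro heq h0
    have := h2.1 fun k hk => by
      rcases Nat.lt_succ_iff_lt_or_eq.1 hk with h3 | h3
      · exact h1 k h3
      · rw [h3, h0]
    omega

theorem eval_mul_of_isHomogeneous {σ : Type*} {h : MvPolynomial σ ℝ} {d : ℕ}
    (hh : h.IsHomogeneous d) (c : ℝ) (z : σ → ℝ) :
    MvPolynomial.eval (fun k => c * z k) h = c ^ d * MvPolynomial.eval z h := by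
  have := aeval_mul_of_isHomogeneous hh c z
  simpa only [aeval_self_eq_eval] using this

theorem abs_eval_linePoly_neg {d : ℕ} (hh : h.IsHomogeneous d) (x a : Fin n → ℝ) (s : ℝ) :
    |(linePoly h (fun k => -x k) a).eval (-s)| = |MvPolynomial.eval (fun k => x k + s * a k) h| := by
  rw [eval_linePoly, aeval_self_eq_eval]
  have h1 : (fun k => -x k + -s * a k) = fun k => -1 * (x k + s * a k) := by funext k; ring
  rw [h1, eval_mul_of_isHomogeneous hh, abs_mul, abs_pow]
  simp

theorem abs_eval_charPoly_neg {d : ℕ} (hh : h.IsHomogeneous d) (x : Fin n → ℝ) (s : ℝ) :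
    |(charPoly h e x).eval (-s)| = |MvPolynomial.eval (fun k => x k + s * e k) h| := by
  rw [charPoly_eq_linePoly, abs_eval_linePoly_neg hh]

theorem X_pow_dvd_comp_C_mul_X {p : ℝ[X]} {m : ℕ} (hp : X ^ m ∣ p) (a : ℝ) :
    X ^ m ∣ p.comp (C a * X) := by
  obtain ⟨q, rfl⟩ := hp
  rw [mul_comp, pow_comp, X_comp, mul_pow]
  exact Dvd.dvd.mul_right (Dvd.intro_left _ rfl) _

theorem IsHyperbolic.X_pow_dvd_charPoly_smul (H : IsHyperbolic h e) {w : Fin n → ℝ} {m : ℕ}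
    (hw : X ^ m ∣ charPoly h e w) {a : ℝ} (ha : 0 < a) :
    X ^ m ∣ charPoly h e (fun k => a * w k) := by
  obtain ⟨d, hh⟩ := H.1
  refine X_pow_dvd_of_abs_eval_neg_le (q := C (a ^ d) * (charPoly h e w).comp (C a⁻¹ * X))
    (fun s hs => le_of_eq ?_) ((X_pow_dvd_comp_C_mul_X hw _).mul_left _)
  rw [abs_eval_charPoly_neg hh, eval_mul, eval_C, eval_comp, eval_mul, eval_C, eval_X, abs_mul,
    mul_neg, abs_eval_charPoly_neg hh, ← abs_mul, ← eval_mul_of_isHomogeneous hh]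
  congr 3
  funext k
  field_simp

theorem IsHyperbolic.X_pow_dvd_charPoly_of_le (H : IsHyperbolic h e) {x y : Fin n → ℝ} {m : ℕ}
    (hx : x ∈ hyperbolicityCone h e) (hy : (fun k => y k - x k) ∈ hyperbolicityCone h e)
    (hd : X ^ m ∣ charPoly h e y) : X ^ m ∣ charPoly h e x := by
  obtain ⟨d, hh⟩ := H.1
  refine X_pow_dvd_of_abs_eval_neg_le (fun s hs => ?_) hd
  rw [abs_eval_charPoly_neg hh, abs_eval_charPoly_neg hh]
  have := H.abs_eval_le_abs_eval_add hx hy hs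
  convert this using 4
  funext k; ring

theorem IsHyperbolic.zero_mem_cone (H : IsHyperbolic h e) :
    (fun _ => 0) ∈ hyperbolicityCone h e := by
  refine mem_hyperbolicityCone_of_forall_pos H.1 fun s hs => ?_
  obtain ⟨d, hh⟩ := H.1
  simp only [zero_add]
  rw [eval_mul_of_isHomogeneous hh]
  exact mul_ne_zero (pow_ne_zero _ hs.ne') H.2.1

theorem IsHyperbolic.smul_mem_cone' (H : IsHyperbolic h e) {v : Fin n → ℝ}
    (hv : v ∈ hyperbolicityCone h e) {a : ℝ} (ha : 0 ≤ a) :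
    (fun k => a * v k) ∈ hyperbolicityCone h e := by
  rcases ha.eq_or_lt with rfl | ha
  · simpa using H.zero_mem_cone
  · exact H.smul_mem_cone hv ha

theorem IsHyperbolic.exists_smul_sub_mem_cone (H : IsHyperbolic h e) (x : Fin n → ℝ) :
    ∃ c : ℝ, 0 < c ∧ (fun k => c * e k - x k) ∈ hyperbolicityCone h e := by
  obtain ⟨M, hM⟩ := (charPoly h e x).roots.toFinset.exists_le
  refine ⟨max M 1, by positivity, mem_hyperbolicityCone_of_forall_pos H.1 fun s hs h0 => ?_⟩
  have hroot : (charPoly h e x).eval (max M 1 + s) = 0 := by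
    rw [eval_charPoly, ← h0]
    congr 2
    funext k; ring
  have := hM _ (by
    rw [Multiset.mem_toFinset]
    exact (mem_roots (H.charPoly_ne_zero x)).2 hroot)
  have := le_max_left M 1
  linarith

/-- Along a direction of rank at most one in the cone, a hyperbolic polynomial is affine from every
interior point of the cone. -/
theorem IsHyperbolic.natDegree_linePoly_le_one (H : IsHyperbolic h e) {x v : Fin n → ℝ}
    (hx : x ∈ hyperbolicityCone h e) (hv : v ∈ hyperbolicityCone h e)
    (hr : hypRank h e v ≤ 1) {s : ℝ} (hs : 0 < s) :
    (linePoly h (fun k => x k + s * e k) (fun k => -v k)).natDegree ≤ 1 := by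
  obtain ⟨d, hh⟩ := H.1
  set y : Fin n → ℝ := fun k => x k + s * e k with hy
  obtain ⟨c, hc, hcy⟩ := H.exists_smul_sub_mem_cone y
  -- By reflection, degree at most one along `v` is vanishing to order `d - 1` along `y` from `-v`.
  -- As `c e - y` is in the cone, `|h (v + t y)| ≤ |h (v + t c e)|`, and the right side vanishes to
  -- that order because `v` has rank at most one.
  have hdvd : X ^ (d - 1) ∣ linePoly h (fun k => -v k) y := by
    have h0 : X ^ (d - 1) ∣ charPoly h e v := by
      rcases Nat.eq_zero_or_pos d with rfl | hd
      · simp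
      · exact (H.X_pow_dvd_charPoly_iff hh v).2 (by omega)
    refine X_pow_dvd_of_abs_eval_neg_le (fun t ht => ?_) (X_pow_dvd_comp_C_mul_X h0 c)
    rw [abs_eval_linePoly_neg hh, eval_comp, eval_mul, eval_C, eval_X, mul_neg,
      abs_eval_charPoly_neg hh]
    have := H.abs_eval_le_abs_eval_add (H.add_mem_cone hv (H.smul_mem_cone hx ht))
      (H.smul_mem_cone hcy ht) (mul_pos ht hs)
    convert this using 4
    · funext k; simp only [hy]; ring
    · funext k; simp only [hy]; ring
  rw [natDegree_le_iff_coeff_eq_zero]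
  intro k hk
  by_cases hkd : k ≤ d
  · rw [coeff_linePoly hh _ _ hkd]
    exact X_pow_dvd_iff.1 hdvd _ (by omega)
  · exact coeff_eq_zero_of_natDegree_lt
      ((natDegree_linePoly_le hh _ _).trans_lt (not_le.1 hkd))

end Rank

/-! ### Coefficients of multiaffine homogeneous polynomials -/

section Multiaffine

variable {E R : Type*} [CommSemiring R]

theorem eq_sum_single_of_mem_support {P : MvPolynomial E R} {r : ℕ} (hP : P.IsHomogeneous r)
    (hd : ∀ i, P.degreeOf i ≤ 1) {m : E →₀ ℕ} (hm : m ∈ P.support) :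
    m = ∑ i ∈ m.support, Finsupp.single i 1 ∧ m.support.card = r := by
  classical
  have h1 : ∀ i ∈ m.support, m i = 1 := fun i hi => by
    have := (MvPolynomial.monomial_le_degreeOf i hm).trans (hd i)
    have := Finsupp.mem_support_iff.1 hi
    omega
  constructor
  · conv_lhs => rw [← Finsupp.sum_single m]
    exact Finset.sum_congr rfl fun i hi => by rw [h1 i hi]
  · rw [hP.degree_eq_sum_deg_support hm, Finset.card_eq_sum_ones]
    exact Finset.sum_congr rfl fun i hi => (h1 i hi).symm

theorem support_sum_single (B : Finset E) :
    (∑ i ∈ B, Finsupp.single i 1 : E →₀ ℕ).support = B := by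
  classical
  ext i
  simp [Finsupp.finsetSum_apply, Finsupp.single_apply]

theorem degree_sum_single (B : Finset E) :
    (∑ i ∈ B, Finsupp.single i 1 : E →₀ ℕ).degree = B.card := by
  simp [map_sum]

-- A monomial that survives at the indicator has its support inside `B`, and both have `r` elements.
open Classical in
theorem eval_indicator_eq_coeff [Fintype E] {P : MvPolynomial E R} {r : ℕ}
    (hP : P.IsHomogeneous r) (hd : ∀ i, P.degreeOf i ≤ 1) {B : Finset E} (hB : B.card = r) :
    MvPolynomial.eval (fun i => if i ∈ B then 1 else 0) P
      = P.coeff (∑ i ∈ B, Finsupp.single i 1) := by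
  rw [MvPolynomial.eval_eq, Finset.sum_eq_single (∑ i ∈ B, Finsupp.single i 1)]
  · rw [support_sum_single, Finset.prod_eq_one, mul_one]
    intro i hi
    simp [hi]
  · intro m hm hne
    obtain ⟨h1, h2⟩ := eq_sum_single_of_mem_support hP hd hm
    have hnot : ¬ m.support ⊆ B := fun hsub => hne (by
      rw [h1, Finset.eq_of_subset_of_card_le hsub (by omega)])
    obtain ⟨i, hi, hiB⟩ := Finset.not_subset.1 hnot
    rw [Finset.prod_eq_zero hi, mul_zero]
    rw [if_neg hiB, zero_pow (Finsupp.mem_support_iff.1 hi)]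
  · intro h0
    rw [MvPolynomial.notMem_support_iff.1 h0, zero_mul]

end Multiaffine

/-! ### The pencil and its lowest coefficient -/

section Pencil

variable {n : ℕ} {h : MvPolynomial (Fin n) ℝ} {e : Fin n → ℝ}
  {E : Type*} [Fintype E] {v : E → Fin n → ℝ}

/-- The linear combination `∑ i, y i • v i`. -/
def combo (v : E → Fin n → ℝ) (y : E → ℝ) : Fin n → ℝ := fun k => ∑ i, v i k * y i

/-- The polynomial `h (t e - ∑ i, x_i v_i)` in `t` with coefficients in `ℝ[x_i]`. -/
def pencil (h : MvPolynomial (Fin n) ℝ) (e : Fin n → ℝ) (v : E → Fin n → ℝ) :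
    Polynomial (MvPolynomial E ℝ) :=
  linePoly h (fun k => -∑ i, MvPolynomial.C (v i k) * MvPolynomial.X i)
    (fun k => MvPolynomial.C (e k))

theorem map_pencil {A : Type*} [CommRing A] [Algebra ℝ A] (z : E → A) :
    (pencil h e v).map (MvPolynomial.aeval (R := ℝ) z : MvPolynomial E ℝ →+* A)
      = linePoly h (fun k => -∑ i, algebraMap ℝ A (v i k) * z i)
          (fun k => algebraMap ℝ A (e k)) := by
  unfold pencil
  rw [map_linePoly]
  congr 1
  · funext k; simp
  · funext k; simp

theorem map_eval_pencil (y : E → ℝ) :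
    (pencil h e v).map (MvPolynomial.eval y) = charPoly h e (combo v y) := by
  rw [charPoly_eq_linePoly, ← MvPolynomial.coe_aeval_eq_eval]
  exact map_pencil y

theorem eval_coeff_pencil (y : E → ℝ) (j : ℕ) :
    MvPolynomial.eval y ((pencil h e v).coeff j) = (charPoly h e (combo v y)).coeff j := by
  rw [← map_eval_pencil, Polynomial.coeff_map]

theorem isHomogeneous_coeff_pencil {d : ℕ} (hh : h.IsHomogeneous d) {i j : ℕ} (hij : i + j = d) :
    ((pencil h e v).coeff i).IsHomogeneous j := by
  refine MvPolynomial.IsHomogeneous.coeff_isHomogeneous_of_optionEquivLeft_symm (n := d) ?_ i j hij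
  have h1 : (MvPolynomial.optionEquivLeft ℝ E).symm (pencil h e v) =
      MvPolynomial.aeval (fun k => -(∑ i, MvPolynomial.C (v i k) * MvPolynomial.X (some i)) +
        MvPolynomial.C (e k) * MvPolynomial.X none) h := by
    rw [AlgEquiv.symm_apply_eq]
    refine Eq.trans ?_ (MvPolynomial.comp_aeval_apply
      (φ := (MvPolynomial.optionEquivLeft ℝ E).toAlgHom) _ h).symm
    unfold pencil linePoly
    congr 2
    funext k
    simp
  rw [h1]
  have := hh.aeval (n := 1) (fun k => -(∑ i, MvPolynomial.C (v i k) * MvPolynomial.X (some i)) +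
        MvPolynomial.C (e k) * MvPolynomial.X (none : Option E)) fun k => ?_
  · simpa using this
  · refine MvPolynomial.IsHomogeneous.add (MvPolynomial.IsHomogeneous.neg
      (MvPolynomial.IsHomogeneous.sum _ _ _ fun i _ => ?_)) ?_ <;>
    exact MvPolynomial.isHomogeneous_C_mul_X _ _

theorem IsHyperbolic.combo_mem_cone (H : IsHyperbolic h e)
    (hv : ∀ i, v i ∈ hyperbolicityCone h e) {y : E → ℝ} (hy : ∀ i, 0 ≤ y i) :
    combo v y ∈ hyperbolicityCone h e := by
  classical
  unfold combo
  induction (Finset.univ : Finset E) using Finset.induction_on with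
  | empty => simpa using H.zero_mem_cone
  | insert i s hi ih =>
    simp_rw [Finset.sum_insert hi]
    refine H.add_mem_cone ?_ ih
    simpa only [mul_comm] using H.smul_mem_cone' (hv i) (hy i)

theorem combo_sub (v : E → Fin n → ℝ) (x y : E → ℝ) :
    combo v (fun i => x i - y i) = fun k => combo v x k - combo v y k := by
  funext k
  simp [combo, mul_sub]

theorem combo_const (v : E → Fin n → ℝ) (c : ℝ) :
    combo v (fun _ => c) = fun k => c * combo v (fun _ => 1) k := by
  funext k
  simp [combo, Finset.mul_sum, mul_comm]

/-- In the cone order, `combo v y` lies below a positive multiple of `∑ v i`, and the order of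
vanishing at `0` can only grow downwards. -/
theorem IsHyperbolic.X_pow_dvd_charPoly_combo (H : IsHyperbolic h e)
    (hv : ∀ i, v i ∈ hyperbolicityCone h e) {m : ℕ}
    (hm : Polynomial.X ^ m ∣ charPoly h e (combo v fun _ => 1)) {y : E → ℝ} (hy : ∀ i, 0 ≤ y i) :
    Polynomial.X ^ m ∣ charPoly h e (combo v y) := by
  obtain ⟨M, hM⟩ := (Finset.univ.image y).exists_le
  have hM' : ∀ i, y i ≤ max M 1 := fun i => (hM _ (by simp)).trans (le_max_left _ _)
  refine H.X_pow_dvd_charPoly_of_le (y := combo v fun _ => max M 1) (H.combo_mem_cone hv hy) ?_ ?_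
  · rw [← combo_sub]
    exact H.combo_mem_cone hv fun i => sub_nonneg.2 (hM' i)
  · rw [combo_const]
    exact H.X_pow_dvd_charPoly_smul hm (by positivity)

theorem IsHyperbolic.X_pow_dvd_pencil (H : IsHyperbolic h e)
    (hv : ∀ i, v i ∈ hyperbolicityCone h e) {m : ℕ}
    (hm : Polynomial.X ^ m ∣ charPoly h e (combo v fun _ => 1)) :
    Polynomial.X ^ m ∣ pencil h e v := by
  rw [Polynomial.X_pow_dvd_iff]
  intro j hj
  refine MvPolynomial.funext_set (fun _ => Set.Ioi (0 : ℝ)) (fun _ => Set.Ioi_infinite 0)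
    fun y hy => ?_
  rw [eval_coeff_pencil, map_zero]
  exact Polynomial.X_pow_dvd_iff.1
    (H.X_pow_dvd_charPoly_combo hv hm fun i => (hy i (Set.mem_univ i)).le) j hj

open Classical in
/-- The coefficients of the pencil are affine in each variable. -/
theorem IsHyperbolic.eval_coeff_pencil_add (H : IsHyperbolic h e)
    (hv : ∀ i, v i ∈ hyperbolicityCone h e) {i : E} (hi : hypRank h e (v i) ≤ 1) {y : E → ℝ}
    (hy : ∀ i, 0 ≤ y i) (hyi : y i = 0) (j : ℕ) (t : ℝ) :
    MvPolynomial.eval (Function.update y i t) ((pencil h e v).coeff j) =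
      (1 - t) * MvPolynomial.eval y ((pencil h e v).coeff j) +
        t * MvPolynomial.eval (Function.update y i 1) ((pencil h e v).coeff j) := by
  obtain ⟨d, hh⟩ := H.1
  have hupd : ∀ t, combo v (Function.update y i t) = fun k => combo v y k + t * v i k := by
    intro t
    funext k
    unfold combo
    rw [← Finset.add_sum_erase _ _ (Finset.mem_univ i),
      ← Finset.add_sum_erase Finset.univ (fun i => v i k * y i) (Finset.mem_univ i), hyi,
      Function.update_self, Finset.sum_congr rfl (fun a ha => by
        rw [Function.update_of_ne (Finset.ne_of_mem_erase ha)])]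
    ring
  have hpoly : charPoly h e (combo v (Function.update y i t)) =
      Polynomial.C (1 - t) * charPoly h e (combo v y) +
        Polynomial.C t * charPoly h e (combo v (Function.update y i 1)) := by
    -- Negative `s` suffice; there `combo v y - s e` is a shifted cone point, from which `h` is
    -- affine along `v i`.
    refine Polynomial.eq_of_infinite_eval_eq _ _ (Set.Infinite.mono ?_ (Set.Iio_infinite 0))
    intro s hs
    have hs' : 0 < -s := neg_pos.2 hs
    have hdeg := H.natDegree_linePoly_le_one (H.combo_mem_cone hv hy) (hv i) hi hs'
    have hval : ∀ t, (charPoly h e (combo v (Function.update y i t))).eval s =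
        (-1) ^ d * (linePoly h (fun k => combo v y k + -s * e k) (fun k => -v i k)).eval (-t) := by
      intro t
      rw [eval_charPoly, eval_linePoly, aeval_self_eq_eval, ← eval_mul_of_isHomogeneous hh, hupd]
      congr 2
      funext k; ring
    have hval0 := hval 0
    rw [show Function.update y i 0 = y from by rw [← hyi, Function.update_eq_self]] at hval0
    change Polynomial.eval s _ = Polynomial.eval s _
    rw [Polynomial.eval_add, Polynomial.eval_mul, Polynomial.eval_mul, Polynomial.eval_C,
      Polynomial.eval_C, hval, hval, hval0, Polynomial.eq_X_add_C_of_natDegree_le_one hdeg]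
    simp
    ring
  rw [eval_coeff_pencil, hpoly, eval_coeff_pencil, eval_coeff_pencil, Polynomial.coeff_add,
    Polynomial.coeff_C_mul, Polynomial.coeff_C_mul]

theorem degreeOf_aeval_update_eq_zero {E : Type*} [DecidableEq E] (P : MvPolynomial E ℝ) (i : E) (c : ℝ) :
    (MvPolynomial.aeval (Function.update MvPolynomial.X i (MvPolynomial.C c)) P
      : MvPolynomial E ℝ).degreeOf i = 0 := by
  rw [← Nat.le_zero]
  rw [MvPolynomial.aeval_def, MvPolynomial.eval₂_eq]
  refine (MvPolynomial.degreeOf_sum_le _ _ _).trans (Finset.sup_le fun m _ => ?_)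
  refine (MvPolynomial.degreeOf_C_mul_le _ _ _).trans ?_
  refine (MvPolynomial.degreeOf_prod_le _ _ _).trans (Finset.sum_nonpos fun j _ => ?_)
  refine (MvPolynomial.degreeOf_pow_le _ _ _).trans ?_
  rcases eq_or_ne j i with rfl | hji
  · simp [MvPolynomial.degreeOf_C]
  · rw [Function.update_of_ne hji, MvPolynomial.degreeOf_X_of_ne hji.symm, mul_zero]

/-- On the positive orthant, hence identically, `P = (1 - x_i) P0 + x_i P1`, where `P0` and `P1` do
not involve `x_i`. -/
theorem degreeOf_le_one_of_eval_update {E : Type*} [DecidableEq E] {P : MvPolynomial E ℝ} {i : E}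
    (hP : ∀ y : E → ℝ, (∀ i, 0 ≤ y i) → y i = 0 → ∀ t : ℝ,
      MvPolynomial.eval (Function.update y i t) P = (1 - t) * MvPolynomial.eval y P +
        t * MvPolynomial.eval (Function.update y i 1) P) : P.degreeOf i ≤ 1 := by
  set P0 : MvPolynomial E ℝ :=
    MvPolynomial.aeval (Function.update MvPolynomial.X i (MvPolynomial.C 0)) P with hP0
  set P1 : MvPolynomial E ℝ :=
    MvPolynomial.aeval (Function.update MvPolynomial.X i (MvPolynomial.C 1)) P with hP1
  have hev : ∀ (c : ℝ) (y : E → ℝ), MvPolynomial.eval y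
      (MvPolynomial.aeval (Function.update MvPolynomial.X i (MvPolynomial.C c)) P
        : MvPolynomial E ℝ) = MvPolynomial.eval (Function.update y i c) P := by
    intro c y
    have h1 := MvPolynomial.map_aeval
      (Function.update MvPolynomial.X i (MvPolynomial.C c) : E → MvPolynomial E ℝ)
      (MvPolynomial.eval y) P
    rw [h1, ← aeval_self_eq_eval P, MvPolynomial.aeval_def]
    change MvPolynomial.eval₂ _ _ P = _
    congr 1
    · ext; simp
    · funext j
      rcases eq_or_ne j i with rfl | hji
      · simp
      · simp [Function.update_of_ne hji]
  have key : P = (1 - MvPolynomial.X i) * P0 + MvPolynomial.X i * P1 := by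
    refine MvPolynomial.funext_set (fun _ => Set.Ioi (0 : ℝ)) (fun _ => Set.Ioi_infinite 0)
      fun y hy => ?_
    have := hP (Function.update y i 0) (fun j => ?_) (by simp) (y i)
    · simp only [Function.update_idem, Function.update_eq_self] at this
      rw [this, map_add, map_mul, map_mul, hP0, hP1, hev, hev]
      simp
    · rcases eq_or_ne j i with rfl | hji
      · simp
      · rw [Function.update_of_ne hji]
        exact (hy j (Set.mem_univ j)).le
  have hX : (1 - MvPolynomial.X i : MvPolynomial E ℝ).degreeOf i ≤ 1 := by
    rw [sub_eq_add_neg]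
    refine (MvPolynomial.degreeOf_add_le _ _ _).trans ?_
    rw [← MvPolynomial.C_1, MvPolynomial.degreeOf_C, ← neg_one_mul, ← MvPolynomial.C_1,
      ← MvPolynomial.C_neg]
    refine max_le (Nat.zero_le _) ((MvPolynomial.degreeOf_C_mul_le _ _ _).trans ?_)
    simp
  rw [key]
  refine (MvPolynomial.degreeOf_add_le _ _ _).trans (max_le ?_ ?_)
  · refine (MvPolynomial.degreeOf_mul_le _ _ _).trans ?_
    rw [hP0, degreeOf_aeval_update_eq_zero]
    exact hX
  · refine (MvPolynomial.degreeOf_mul_le _ _ _).trans ?_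
    rw [hP1, degreeOf_aeval_update_eq_zero]
    simp

theorem IsHyperbolic.degreeOf_coeff_pencil_le (H : IsHyperbolic h e)
    (hv : ∀ i, v i ∈ hyperbolicityCone h e) {i : E} (hi : hypRank h e (v i) ≤ 1) (j : ℕ) :
    ((pencil h e v).coeff j).degreeOf i ≤ 1 := by
  classical
  exact degreeOf_le_one_of_eval_update fun y hy hyi t => by
    convert H.eval_coeff_pencil_add hv hi hy hyi j t

-- The common factor `s ^ m` cancels before `s → 0`. Only its modulus matters, so the two sides may
-- approach `0` along different directions.
open Filter Topology in
theorem norm_eval_zero_le_of_forall_pos {p q : Polynomial ℂ} {m : ℕ} {a b : ℂ}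
    (ha : ‖a‖ = 1) (hb : ‖b‖ = 1)
    (hpq : ∀ s : ℝ, 0 < s → ‖(Polynomial.X ^ m * p).eval (s * a)‖ ≤
      ‖(Polynomial.X ^ m * q).eval (s * b)‖) : ‖p.eval 0‖ ≤ ‖q.eval 0‖ := by
  have h1 : ∀ (p : Polynomial ℂ) (a : ℂ),
      Tendsto (fun s : ℝ => ‖p.eval (s * a)‖) (𝓝[>] 0) (𝓝 ‖p.eval (((0 : ℝ) : ℂ) * a)‖) :=
    fun p a => (Continuous.tendsto (by fun_prop) (0 : ℝ)).mono_left nhdsWithin_le_nhds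
  have := le_of_tendsto_of_tendsto (h1 p a) (h1 q b) (by
    filter_upwards [self_mem_nhdsWithin] with s hs
    have hs' : 0 < s := hs
    have h2 := hpq s hs'
    simp only [Polynomial.eval_mul, Polynomial.eval_pow, Polynomial.eval_X, norm_mul, norm_pow,
      ha, hb, mul_one, Complex.norm_real] at h2
    exact le_of_mul_le_mul_left h2 (pow_pos (norm_pos_iff.2 hs'.ne') m))
  simpa using this

theorem norm_eval_pencil_neg {d : ℕ} (hh : h.IsHomogeneous d) (z : E → ℂ) (s : ℂ) :
    ‖((pencil h e v).map
        (MvPolynomial.aeval (R := ℝ) z : MvPolynomial E ℝ →+* ℂ)).eval (-s)‖ =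
      ‖MvPolynomial.aeval (fun k => ∑ i, (v i k : ℂ) * z i + s * (e k : ℂ)) h‖ := by
  rw [map_pencil, eval_linePoly]
  have h1 : (fun k => -∑ i, algebraMap ℝ ℂ (v i k) * z i + -s * algebraMap ℝ ℂ (e k)) =
      fun k => -(∑ i, (v i k : ℂ) * z i + s * (e k : ℂ)) := by
    funext k
    simp only [Complex.coe_algebraMap]
    ring
  rw [h1, eval_neg_of_isHomogeneous hh, norm_mul, norm_pow, norm_neg, norm_one, one_pow, one_mul]

section Lowest

variable {G : Polynomial (MvPolynomial E ℝ)} {m : ℕ}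

theorem norm_aeval_coeff_zero_le {d : ℕ} (hh : h.IsHomogeneous d)
    (hG : pencil h e v = Polynomial.X ^ m * G) {z w : E → ℂ} {a b : ℂ}
    (ha : ‖a‖ = 1) (hb : ‖b‖ = 1)
    (hle : ∀ s : ℝ, 0 < s →
      ‖MvPolynomial.aeval (fun k => ∑ i, (v i k : ℂ) * z i + s * a * (e k : ℂ)) h‖ ≤
      ‖MvPolynomial.aeval (fun k => ∑ i, (v i k : ℂ) * w i + s * b * (e k : ℂ)) h‖) :
    ‖MvPolynomial.aeval z (G.coeff 0)‖ ≤ ‖MvPolynomial.aeval w (G.coeff 0)‖ := by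
  have hc : ∀ z : E → ℂ, MvPolynomial.aeval z (G.coeff 0) =
      (G.map (MvPolynomial.aeval (R := ℝ) z : MvPolynomial E ℝ →+* ℂ)).eval 0 := by
    intro z
    rw [← Polynomial.coeff_zero_eq_eval_zero, Polynomial.coeff_map]
    rfl
  have hX : ∀ z : E → ℂ, Polynomial.X ^ m *
      G.map (MvPolynomial.aeval (R := ℝ) z : MvPolynomial E ℝ →+* ℂ) =
      (pencil h e v).map (MvPolynomial.aeval (R := ℝ) z : MvPolynomial E ℝ →+* ℂ) := by
    intro z
    rw [hG]
    simp
  rw [hc, hc]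
  refine norm_eval_zero_le_of_forall_pos (m := m) (a := -a) (b := -b) (by simpa) (by simpa)
    fun s hs => ?_
  rw [hX, hX, mul_neg, mul_neg, norm_eval_pencil_neg hh,
    norm_eval_pencil_neg hh]
  exact hle s hs

theorem IsHyperbolic.norm_aeval_coeff_zero_le_of_im (H : IsHyperbolic h e)
    (hv : ∀ i, v i ∈ hyperbolicityCone h e) (hG : pencil h e v = Polynomial.X ^ m * G)
    {z : E → ℂ} (hz : ∀ i, 0 ≤ (z i).im) :
    ‖MvPolynomial.aeval (fun i => ((z i).im : ℂ)) (G.coeff 0)‖ ≤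
      ‖MvPolynomial.aeval z (G.coeff 0)‖ := by
  obtain ⟨d, hh⟩ := H.1
  -- The direction `I` on the right arises from `u + I (v + s e) = (u + I v) + s I e`.
  refine norm_aeval_coeff_zero_le hh hG (a := 1) (b := Complex.I) (by simp) (by simp)
    fun s hs => ?_
  have h1 := H.abs_eval_le_norm_aeval (H.combo_mem_cone hv hz) hs (combo v fun i => (z i).re)
  rw [← Real.norm_eq_abs, ← Complex.norm_real, ← aeval_ofReal] at h1
  convert h1 using 4
  · funext k
    simp [combo]
  · funext k
    have h2 : ∀ i, (v i k : ℂ) * z i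
        = (v i k : ℂ) * (z i).re + Complex.I * ((v i k : ℂ) * (z i).im) := fun i => by
      conv_lhs => rw [← Complex.re_add_im (z i)]
      ring
    simp only [combo, h2, Finset.sum_add_distrib, ← Finset.mul_sum]
    push_cast
    ring

theorem IsHyperbolic.norm_aeval_coeff_zero_le_of_le (H : IsHyperbolic h e)
    (hv : ∀ i, v i ∈ hyperbolicityCone h e) (hG : pencil h e v = Polynomial.X ^ m * G)
    {x y : E → ℝ} (hx : ∀ i, 0 ≤ x i) (hxy : ∀ i, x i ≤ y i) :
    ‖MvPolynomial.aeval (fun i => (x i : ℂ)) (G.coeff 0)‖ ≤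
      ‖MvPolynomial.aeval (fun i => (y i : ℂ)) (G.coeff 0)‖ := by
  obtain ⟨d, hh⟩ := H.1
  refine norm_aeval_coeff_zero_le hh hG (a := 1) (b := 1) (by simp) (by simp) fun s hs => ?_
  have h1 := H.abs_eval_le_abs_eval_add (H.combo_mem_cone hv hx)
    (H.combo_mem_cone hv (y := fun i => y i - x i) fun i => sub_nonneg.2 (hxy i)) hs
  rw [← Real.norm_eq_abs, ← Real.norm_eq_abs, ← Complex.norm_real, ← Complex.norm_real,
    ← aeval_ofReal, ← aeval_ofReal, combo_sub] at h1
  convert h1 using 4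
  · funext k
    simp [combo]
  · funext k
    simp [combo]
    ring

end Lowest

end Pencil

/-! ### Hyperbolic matroids have the weak half-plane property -/

section Matroid

variable {E : Type*} [Finite E] {M : Matroid E}

theorem isBase_iff_encard (M : Matroid E) (B : Set E) :
    M.IsBase B ↔ B.encard = M.eRank ∧ M.eRk B = M.eRank := by
  constructor
  · intro hB
    exact ⟨hB.encard_eq_eRank, hB.eRk_eq_eRank⟩
  · rintro ⟨h1, h2⟩
    have hI : M.Indep B :=
      (Matroid.indep_iff_eRk_eq_encard_of_finite (Set.toFinite B)).2 (h2.trans h1.symm)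
    exact hI.isBase_of_eRk_ge (Set.toFinite B) h2.ge

theorem setCoeff_map {E : Type*} (P : MvPolynomial E ℝ) (B : Finset E) :
    setCoeff (MvPolynomial.map (algebraMap ℝ ℂ) P) B =
      ((P.coeff (∑ i ∈ B, Finsupp.single i 1) : ℝ) : ℂ) := by
  unfold setCoeff
  rw [MvPolynomial.coeff_map]
  rfl

theorem IsHyperbolicMatroid.hasWeakHalfPlaneProperty (hM : IsHyperbolicMatroid M) :
    HasWeakHalfPlaneProperty M := by
  classical
  have := Fintype.ofFinite E
  obtain ⟨n, h, e, v, H, hv, hv1, hrk⟩ := hM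
  obtain ⟨d, hh⟩ := H.1
  have hsum : ∀ S : Finset E, ∑ i ∈ S, v i = combo v fun i => if i ∈ S then 1 else 0 := by
    intro S
    funext k
    simp [combo]
  set r := hypRank h e (combo v fun _ => 1) with hr
  have hrd : r ≤ d := H.hypRank_le hh _
  have hrank : M.eRank = r := by
    rw [← M.eRk_univ_eq, ← Finset.coe_univ, hrk, hypRankFn, hsum]
    simp [hr]
  have hdvd : Polynomial.X ^ (d - r) ∣ charPoly h e (combo v fun _ => 1) :=
    (H.X_pow_dvd_charPoly_iff hh _).2 (by omega)
  obtain ⟨G, hG⟩ := H.X_pow_dvd_pencil hv hdvd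
  set P := G.coeff 0 with hP
  have hPc : P = (pencil h e v).coeff (d - r) := by
    rw [hG]
    simp [hP, Polynomial.coeff_X_pow_mul']
  have hhom : P.IsHomogeneous r := by
    rw [hPc]
    exact isHomogeneous_coeff_pencil hh (by omega)
  have hdeg : ∀ i, P.degreeOf i ≤ 1 := fun i => by
    rw [hPc]
    exact H.degreeOf_coeff_pencil_le hv (hv1 i) _
  refine ⟨MvPolynomial.map (algebraMap ℝ ℂ) P, ⟨r, hhom.map _⟩, fun i => ?_, fun z hz => ?_,
    fun B => ?_⟩
  · rw [MvPolynomial.degreeOf_le_iff]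
    intro m hm
    exact MvPolynomial.degreeOf_le_iff.1 (hdeg i) m (MvPolynomial.support_map_subset _ _ hm)
  · rw [MvPolynomial.eval_map, ← MvPolynomial.aeval_def]
    -- A common lower bound `c` reduces nonvanishing at `z` to `P (c, ..., c) = c ^ r * P (1, ...,
    -- 1)`, which is nonzero by the choice of `r`.
    obtain ⟨c, hc⟩ : ∃ c : ℝ, 0 < c ∧ ∀ i, c ≤ (z i).im := by
      rcases isEmpty_or_nonempty E with hE | hE
      · exact ⟨1, one_pos, fun i => (IsEmpty.false i).elim⟩
      · obtain ⟨i, hi⟩ := Finite.exists_min fun i => (z i).im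
        exact ⟨(z i).im, hz i, hi⟩
    have h1 := H.norm_aeval_coeff_zero_le_of_im hv hG fun i => (hz i).le
    have h2 := H.norm_aeval_coeff_zero_le_of_le hv hG (x := fun _ => c) (fun _ => hc.1.le) hc.2
    have h3 : MvPolynomial.eval (fun _ : E => (1 : ℝ)) P ≠ 0 := by
      rw [hPc, eval_coeff_pencil]
      exact (H.coeff_charPoly_ne_zero_iff hh le_rfl hrd).2 rfl
    have h4 : MvPolynomial.eval (fun _ : E => c) P ≠ 0 := by
      have := eval_mul_of_isHomogeneous hhom c fun _ => 1
      rw [mul_one] at this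
      rw [this]
      exact mul_ne_zero (pow_ne_zero _ hc.1.ne') h3
    rw [aeval_ofReal, Complex.norm_real] at h2
    exact norm_pos_iff.1 ((norm_pos_iff.2 h4).trans_le (h2.trans h1))
  · rw [isBase_iff_encard, hrank, Set.encard_coe_eq_coe_finsetCard, setCoeff_map, Nat.cast_inj,
      hrk, Nat.cast_inj, Complex.ofReal_ne_zero]
    by_cases hB : B.card = r
    · rw [← eval_indicator_eq_coeff hhom hdeg hB, hPc, eval_coeff_pencil, ← hsum]
      have hle : hypRank h e (∑ i ∈ B, v i) ≤ r := by
        have := M.eRk_le_eRank (B : Set E)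
        rw [hrank, hrk] at this
        exact_mod_cast this
      rw [H.coeff_charPoly_ne_zero_iff hh hle hrd]
      exact and_iff_right hB
    · refine ⟨fun h1 => (hB h1.1).elim, fun h1 => (h1 ?_).elim⟩
      exact hhom.coeff_eq_zero (by rwa [degree_sum_single])

end Matroid

/-! ### Homogeneous stable polynomials are real up to a scalar -/

section Stable

variable {E : Type*} {P : MvPolynomial E ℂ} {d : ℕ}

theorem eval_mul_of_isHomogeneous_complex (hP : P.IsHomogeneous d) (c : ℂ) (z : E → ℂ) :
    MvPolynomial.eval (fun k => c * z k) P = c ^ d * MvPolynomial.eval z P := by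
  have := aeval_mul_of_isHomogeneous hP c z
  simpa only [aeval_self_eq_eval] using this

theorem IsStable.im_eq_zero (hs : IsStable P) (hP : P.IsHomogeneous d) (x : E → ℝ) {t : ℂ}
    (ht : MvPolynomial.eval (fun i => (x i : ℂ) + t) P = 0) : t.im = 0 := by
  by_contra hne
  rcases lt_or_gt_of_ne hne with h | h
  · refine hs (fun i => -1 * ((x i : ℂ) + t)) (fun i => by simpa using h) ?_
    rw [eval_mul_of_isHomogeneous_complex hP, ht, mul_zero]
  · exact hs _ (fun i => by simpa using h) ht

theorem IsStable.eval_ne_zero_of_pos (hs : IsStable P) (hP : P.IsHomogeneous d) {x : E → ℝ}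
    (hx : ∀ i, 0 < x i) : MvPolynomial.eval (fun i => (x i : ℂ)) P ≠ 0 := by
  intro h0
  refine hs (fun i => Complex.I * (x i : ℂ)) (fun i => by simpa using hx i) ?_
  rw [eval_mul_of_isHomogeneous_complex hP, h0, mul_zero]

/-- On the nonnegative orthant, a homogeneous stable polynomial has constant phase. -/
theorem IsStable.exists_eval_eq_mul (hs : IsStable P) (hP : P.IsHomogeneous d) {x : E → ℝ}
    (hx : ∀ i, 0 ≤ x i) : ∃ r : ℝ, 0 ≤ r ∧
      MvPolynomial.eval (fun i => (x i : ℂ)) P = MvPolynomial.eval (fun _ => 1) P * r := by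
  have h1 : MvPolynomial.eval (fun _ => 1) P ≠ 0 := by
    simpa using hs.eval_ne_zero_of_pos hP (x := fun _ => 1) fun _ => one_pos
  set p := linePoly P (fun i => (x i : ℂ)) (fun _ => 1) with hp
  have hev : ∀ t, p.eval t = MvPolynomial.eval (fun i => (x i : ℂ) + t) P := by
    intro t
    rw [hp, eval_linePoly, aeval_self_eq_eval]
    simp
  have hlead : p.leadingCoeff = MvPolynomial.eval (fun _ => 1) P := by
    have hc : p.coeff d = MvPolynomial.eval (fun _ => 1) P := by
      rw [hp, coeff_linePoly_top hP, aeval_self_eq_eval]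
    have : p.natDegree = d := le_antisymm (natDegree_linePoly_le hP _ _)
      (Polynomial.le_natDegree_of_ne_zero (by rwa [hc]))
    rw [Polynomial.leadingCoeff, this, hc]
  -- The zeros of `t ↦ P (x + t)` are real, and none is positive since `x + t` would have positive
  -- coordinates.
  have := exists_eval_zero_eq_leadingCoeff_mul (p := p) fun t ht => by
    rw [hev] at ht
    have him := hs.im_eq_zero hP x ht
    refine ⟨him, not_lt.1 fun hpos => ?_⟩
    refine hs.eval_ne_zero_of_pos hP (x := fun i => x i + t.re)
      (fun i => add_pos_of_nonneg_of_pos (hx i) hpos) ?_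
    rw [← ht]
    congr 2
    funext i
    apply Complex.ext <;> simp [him]
  rw [hev, hlead] at this
  simpa using this

theorem IsStable.exists_coeff_eq_mul [Finite E] (hs : IsStable P) (hP : P.IsHomogeneous d)
    (hm : IsMultiaffine P) (m : E →₀ ℕ) :
    ∃ r : ℝ, 0 ≤ r ∧ P.coeff m = MvPolynomial.eval (fun _ => 1) P * r := by
  classical
  have := Fintype.ofFinite E
  by_cases h0 : m ∈ P.support
  · obtain ⟨h1, h2⟩ := eq_sum_single_of_mem_support hP hm h0
    obtain ⟨r, hr, h3⟩ := hs.exists_eval_eq_mul hP (x := fun i => if i ∈ m.support then 1 else 0)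
      fun i => by split_ifs <;> norm_num
    refine ⟨r, hr, ?_⟩
    rw [h1, ← eval_indicator_eq_coeff hP hm h2, ← h3]
    congr 2
    funext i
    split_ifs <;> simp
  · exact ⟨0, le_rfl, by simp [MvPolynomial.notMem_support_iff.1 h0]⟩

/-- A homogeneous multiaffine stable polynomial is a multiple of a real polynomial with nonnegative
coefficients. -/
theorem IsStable.exists_real [Finite E] (hs : IsStable P) (hP : P.IsHomogeneous d)
    (hm : IsMultiaffine P) : ∃ (Q : MvPolynomial E ℝ) (c : ℂ), c ≠ 0 ∧
      (∀ m, 0 ≤ Q.coeff m) ∧ (∀ m, P.coeff m = c * Q.coeff m) ∧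
      P = MvPolynomial.C c * MvPolynomial.map (algebraMap ℝ ℂ) Q := by
  set c := MvPolynomial.eval (fun _ => 1) P with hc
  have hc0 : c ≠ 0 := by
    simpa using hs.eval_ne_zero_of_pos hP (x := fun _ => 1) fun _ => one_pos
  choose r hr hPr using hs.exists_coeff_eq_mul hP hm
  obtain ⟨Q, hQ⟩ : ∃ Q, MvPolynomial.map (algebraMap ℝ ℂ) Q = MvPolynomial.C c⁻¹ * P := by
    refine MvPolynomial.mem_range_map_iff_coeffs_subset.2 ?_
    intro z hz
    rw [Finset.mem_coe, MvPolynomial.mem_coeffs_iff] at hz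
    obtain ⟨m, -, rfl⟩ := hz
    refine ⟨r m, ?_⟩
    rw [MvPolynomial.coeff_C_mul, hPr, inv_mul_cancel_left₀ hc0]
    rfl
  have hPQ : P = MvPolynomial.C c * MvPolynomial.map (algebraMap ℝ ℂ) Q := by
    rw [hQ, ← mul_assoc, ← MvPolynomial.C_mul, mul_inv_cancel₀ hc0, MvPolynomial.C_1, one_mul]
  have hcoeff : ∀ m, P.coeff m = c * Q.coeff m := fun m => by
    conv_lhs => rw [hPQ]
    rw [MvPolynomial.coeff_C_mul, MvPolynomial.coeff_map]
    rfl
  refine ⟨Q, c, hc0, fun m => ?_, hcoeff, hPQ⟩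
  have h1 := hcoeff m
  rw [hPr] at h1
  have h2 : r m = Q.coeff m := Complex.ofReal_injective (mul_left_cancel₀ hc0 h1)
  exact h2 ▸ hr m

end Stable

/-! ### The weak half-plane property implies hyperbolicity -/

section Rank

open Polynomial in
theorem prod_X_sub_indicator {E : Type*} [DecidableEq E] (B S : Finset E) :
    ∏ i ∈ B, (X - C (if i ∈ S then (1 : ℝ) else 0)) =
      (X - C 1) ^ (B ∩ S).card * X ^ (B \ S).card := by
  rw [← Finset.prod_inter_mul_prod_sdiff B S]
  congr 1
  · rw [← Finset.prod_const]
    refine Finset.prod_congr rfl fun i hi => ?_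
    rw [if_pos (Finset.mem_inter.1 hi).2]
  · rw [← Finset.prod_const]
    refine Finset.prod_congr rfl fun i hi => ?_
    rw [if_neg (Finset.mem_sdiff.1 hi).2, C_0, sub_zero]

variable {E : Type*} [Finite E] {M : Matroid E}

theorem encard_inter_le_eRk {E : Type*} {M : Matroid E} {B : Set E} (hB : M.IsBase B) (S : Set E) :
    (B ∩ S).encard ≤ M.eRk S :=
  (hB.indep.subset Set.inter_subset_left).encard_le_eRk_of_subset Set.inter_subset_right

/-- Extending a basis of `S` to a base shows that the bound `encard_inter_le_eRk` is attained: the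
rank of `S` is the largest `|B ∩ S|`. -/
theorem exists_isBase_encard_inter_eq {E : Type*} {M : Matroid E} (hM : M.E = Set.univ) (S : Set E) :
    ∃ B, M.IsBase B ∧ (B ∩ S).encard = M.eRk S := by
  obtain ⟨I, hI⟩ := M.exists_isBasis S (by rw [hM]; exact Set.subset_univ S)
  obtain ⟨B, hB, hIB⟩ := hI.indep.exists_isBase_superset
  refine ⟨B, hB, le_antisymm (encard_inter_le_eRk hB S) ?_⟩
  rw [← hI.encard_eq_eRk]
  exact Set.encard_le_encard (Set.subset_inter hIB hI.subset)

open Polynomial in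
theorem HasWeakHalfPlaneProperty.isHyperbolicMatroid (hM : M.E = Set.univ)
    (h : HasWeakHalfPlaneProperty M) : IsHyperbolicMatroid M := by
  classical
  have := Fintype.ofFinite E
  obtain ⟨P, ⟨d, hP⟩, hm, hs, hB⟩ := h
  obtain ⟨Q, c, hc, hQ0, hPQ, hPmap⟩ := hs.exists_real hP hm
  have hevQ : ∀ z : E → ℂ, MvPolynomial.eval z P = c * MvPolynomial.aeval z Q := by
    intro z
    rw [hPmap, map_mul, MvPolynomial.eval_C, MvPolynomial.eval_map, MvPolynomial.aeval_def]
  have hposQ : ∀ x : E → ℝ, (∀ i, 0 < x i) → MvPolynomial.eval x Q ≠ 0 := by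
    intro x hx h0
    apply hs.eval_ne_zero_of_pos hP hx
    rw [hevQ, aeval_ofReal, h0, Complex.ofReal_zero, mul_zero]
  have hsupp : ∀ m, m ∈ Q.support ↔ m ∈ P.support := by
    intro m
    simp [MvPolynomial.mem_support_iff, hPQ, hc]
  have hbase : ∀ m ∈ Q.support, m = ∑ i ∈ m.support, Finsupp.single i 1 ∧ m.support.card = d ∧
      M.IsBase (m.support : Set E) := by
    intro m hmQ
    have hmP := (hsupp m).1 hmQ
    obtain ⟨h1, h2⟩ := eq_sum_single_of_mem_support hP hm hmP
    refine ⟨h1, h2, (hB _).2 ?_⟩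
    rw [setCoeff, ← h1]
    exact MvPolynomial.mem_support_iff.1 hmP
  have hQhom : Q.IsHomogeneous d := by
    intro m hmQ
    exact hP (MvPolynomial.mem_support_iff.1 ((hsupp m).1 (MvPolynomial.mem_support_iff.2 hmQ)))
  obtain ⟨n, ⟨σ⟩⟩ := Finite.exists_equiv_fin E
  set g := MvPolynomial.rename σ Q with hg
  set e : Fin n → ℝ := fun _ => 1 with he
  set v : E → Fin n → ℝ := fun i => Pi.single (σ i) 1 with hv
  have hgh : g.IsHomogeneous d := hQhom.rename_isHomogeneous
  have H : IsHyperbolic g e := by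
    refine ⟨⟨d, hgh⟩, ?_, fun x z hz => ?_⟩
    · rw [hg, MvPolynomial.eval_rename]
      exact hposQ _ fun _ => one_pos
    · rw [aeval_charPoly, hg, MvPolynomial.aeval_rename] at hz
      refine hs.im_eq_zero hP (fun i => -x (σ i)) (t := z) ?_
      rw [hevQ, ← mul_zero c, ← hz]
      congr 3
      funext i
      simp [he]
  have hcone : ∀ i, v i ∈ hyperbolicityCone g e := by
    intro i
    refine mem_hyperbolicityCone_of_forall_pos ⟨d, hgh⟩ fun s hs => ?_
    rw [hg, MvPolynomial.eval_rename]
    refine hposQ _ fun j => ?_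
    have : 0 ≤ v i (σ j) := by
      simp only [hv, Pi.single_apply]
      split_ifs <;> norm_num
    simp only [he, Function.comp]
    linarith
  have hsum : ∀ S : Finset E, ∑ i ∈ S, v i = fun k => if σ.symm k ∈ S then 1 else 0 := by
    intro S
    funext k
    simp [hv, Finset.sum_apply, Pi.single_apply, ← σ.symm_apply_eq]
  have hchar : ∀ S : Finset E, charPoly g e (∑ i ∈ S, v i) = ∑ m ∈ Q.support,
      C (Q.coeff m) * ((X - C 1) ^ (m.support ∩ S).card * X ^ (m.support \ S).card) := by
    intro S
    rw [charPoly, hg, MvPolynomial.aeval_rename, MvPolynomial.aeval_def, MvPolynomial.eval₂_eq]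
    refine Finset.sum_congr rfl fun m hmQ => ?_
    rw [← prod_X_sub_indicator]
    congr 1
    refine Finset.prod_congr rfl fun i hi => ?_
    have h1 : m i = 1 := by
      rw [(hbase m hmQ).1, Finsupp.finsetSum_apply]
      simp only [Finsupp.single_apply, Finset.sum_ite_eq', if_pos hi]
    rw [h1, pow_one, hsum]
    simp [he]
  have hrank : ∀ S : Finset E, M.eRk (S : Set E) = (hypRankFn g e v S : ℕ∞) := by
    intro S
    obtain ⟨B0, hB0, hB0S⟩ := exists_isBase_encard_inter_eq hM (S : Set E)
    obtain ⟨B, rfl⟩ := B0.toFinite.exists_finset_coe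
    rw [← Finset.coe_inter, Set.encard_coe_eq_coe_finsetCard] at hB0S
    set r := (B ∩ S).card with hr
    rw [← hB0S, Nat.cast_inj]
    set m0 : E →₀ ℕ := ∑ i ∈ B, Finsupp.single i 1 with hm0
    have hm0s : m0.support = B := support_sum_single B
    have hm0Q : m0 ∈ Q.support := (hsupp _).2 (MvPolynomial.mem_support_iff.2 ((hB B).1 hB0))
    have hcard : ∀ m ∈ Q.support, (m.support ∩ S).card ≤ r ∧
        (m.support ∩ S).card + (m.support \ S).card = d := by
      intro m hmQ
      obtain ⟨-, h2, h3⟩ := hbase m hmQ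
      constructor
      · have := encard_inter_le_eRk h3 (S : Set E)
        rw [← hB0S, ← Finset.coe_inter, Set.encard_coe_eq_coe_finsetCard] at this
        exact_mod_cast this
      · rw [Finset.card_inter_add_card_sdiff, h2]
    have hrd : r ≤ d := by
      have := (hcard m0 hm0Q).2
      rw [hm0s] at this
      omega
    have hdvd : X ^ (d - r) ∣ charPoly g e (∑ i ∈ S, v i) := by
      rw [hchar]
      refine Finset.dvd_sum fun m hmQ => ((pow_dvd_pow X ?_).mul_left _).mul_left _
      have := hcard m hmQ
      omega
    have hle : hypRank g e (∑ i ∈ S, v i) ≤ r := by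
      have := (H.X_pow_dvd_charPoly_iff hgh _).1 hdvd
      omega
    refine ((H.coeff_charPoly_ne_zero_iff hgh hle hrd).1 ?_).symm
    -- The power of `X` is `d - |B ∩ S| ≥ d - r`, so only the bases with `|B ∩ S| = r` contribute,
    -- each with the sign `(-1) ^ r`.
    have hterm : ∀ m ∈ Q.support, (C (Q.coeff m) * ((X - C 1) ^ (m.support ∩ S).card *
        X ^ (m.support \ S).card)).coeff (d - r) =
        (-1) ^ r * (Q.coeff m * if (m.support ∩ S).card = r then 1 else 0) := by
      intro m hmQ
      obtain ⟨h1, h2⟩ := hcard m hmQ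
      rw [coeff_C_mul, coeff_mul_X_pow']
      by_cases h3 : (m.support ∩ S).card = r
      · rw [if_pos h3, if_pos (by omega), show d - r - (m.support \ S).card = 0 by omega, h3,
          coeff_zero_eq_eval_zero]
        simp [mul_comm]
      · rw [if_neg h3, if_neg (by omega)]
        simp
    rw [hchar, finsetSum_coeff, Finset.sum_congr rfl hterm, ← Finset.mul_sum]
    refine mul_ne_zero (pow_ne_zero _ (by norm_num)) (ne_of_gt ?_)
    -- Nonnegative coefficients rule out cancellation, and the base `B` contributes a positive term.
    refine Finset.sum_pos' (fun m _ => mul_nonneg (hQ0 m) (by split_ifs <;> norm_num))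
      ⟨m0, hm0Q, ?_⟩
    rw [hm0s, if_pos hr.symm, mul_one]
    exact lt_of_le_of_ne (hQ0 m0) (MvPolynomial.mem_support_iff.1 hm0Q).symm
  refine ⟨n, g, e, v, H, hcone, fun i => ?_, hrank⟩
  have h1 := hrank {i}
  have h2 := M.eRk_singleton_le i
  rw [Finset.coe_singleton] at h1
  rw [h1, hypRankFn, Finset.sum_singleton] at h2
  exact_mod_cast h2

end Rank

end HypMatroid

end

theorem mainTheorem10 {E : Type*} [Finite E] (M : Matroid E) (hM : M.E = Set.univ) :
    HypMatroid.IsHyperbolicMatroid M ↔ HypMatroid.HasWeakHalfPlaneProperty M :=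
  ⟨fun h => h.hasWeakHalfPlaneProperty, fun h => h.isHyperbolicMatroid hM⟩
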